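/- Work on $\mathfrak H=L^2(\mathbb R,dx)$ with the inner product linear in the second argument. For $z=(q+ip)/\sqrt2\in\mathbb C$ let $D(z)=e^{za^\dagger-\bar z a}$ be the displacement operator, $(D(z)\phi)(x)=e^{ip(x-q/2)}\phi(x-q)$. Let $\varpi:\mathbb C\to\mathbb C$ with $\varpi(0)=1$ define a bounded operator $M=\int_{\mathbb C}\varpi(z)D(z)\,\frac{d^2z}{\pi}$ in the weak sense: there is a dense subspace $V\subset\mathfrak H$, invariant under all $D(z)$, such that for all $\phi,\psi\in V$ the integral $\int\varpi(z)\langle\phi,D(z)\psi\rangle\frac{d^2z}{\pi}$ converges absolutely and equals $\langle\phi,M\psi\rangle$. For a function $f$ on $\mathbb C$, its quantization is the bounded operator $A_f=\int_{\mathbb C}f(z)\,D(z)MD(z)^\dagger\,\frac{d^2z}{\pi}$, when it exists, in the sense that $\langle\phi,A_f\psi\rangle=\int f(z)\langle\phi,D(z)MD(z)^\dagger\psi\rangle\frac{d^2z}{\pi}$, with absolute convergence, for all $\phi,\psi\in\mathfrak H$. Write $L^p=L^p(\mathbb C,\frac{d^2z}{\pi})$. 1. The following are equivalent: (a) every $f\in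 L^2$ has a quantization $A_f$, and $\mathrm{tr}(A_f^\dagger A_f)=\int_{\mathbb C}|f(z)|^2\,\frac{d^2z}{\pi}$; (b) the same holds for every $f\in L^1\cap L^2$; (c) $|\varpi(z)|=1$ for almost every $z\in\mathbb C$. If $\varpi$ is continuous, (c) may be replaced by: $|\varpi(z)|=1$ for all $z\in\mathbb C$. 2. If these conditions hold, then $f\mapsto A_f$ is a bijection of $L^2$ (modulo equality almost everywhere) onto the Hilbert–Schmidt operators on $\mathfrak H$, and its inverse is $A\mapsto W_A$, $W_A(z)=\mathrm{tr}\big(D(z)M^\dagger D(z)^\dagger A\big)$. Here, if $A$ is trace class, the trace exists for every $z$; for a general Hilbert–Schmidt operator $A$ the formula means that, for every orthonormal basis $(b_n)_{n\in\mathbb N}$ of $\mathfrak H$, the series $\sum_n\langle b_n,D(z)M^\dagger D(z)^\dagger A\,b_n\rangle$ converges unconditionally in $L^2$ to $W_A$. 3. If moreover $\varpi$ is regular, that is $\varpi(-z)=\varpi(z)$ and $\overline{\varpi(z)}=\varpi(z)$ for all $z$, then $M=M^\dagger$, so that the inverse is $A\mapsto\mathrm{tr}\big(D(z)MD(z)^\dagger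 A\big)$, with the trace understood in the same way. -/

import Mathlib

open MeasureTheory Filter Topology
open scoped ENNReal InnerProductSpace

noncomputable section

namespace WeylHeisenberg

/-- The Hilbert space `L²(ℝ, dx)` carrying the Schrödinger representation. -/
abbrev H : Type := Lp ℂ 2 (volume : Measure ℝ)

/-- The invariant measure `d²z / π` on the phase space `ℂ`. -/
def phaseMeasure : Measure ℂ := ENNReal.ofReal Real.pi⁻¹ • volume

/-- Position coordinate: `z = (q + i p) / √2`. -/
def pos (z : ℂ) : ℝ := √2 * z.re

/-- Momentum coordinate: `z = (q + i p) / √2`. -/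
def mom (z : ℂ) : ℝ := √2 * z.im

/-- The function `x ↦ e^{i p (x - q/2)} φ (x - q)`, for `z = (q + i p) / √2`. -/
def displaceFun (z : ℂ) (φ : ℝ → ℂ) (x : ℝ) : ℂ :=
  Complex.exp (((mom z * (x - pos z / 2) : ℝ) : ℂ) * Complex.I) * φ (x - pos z)

theorem phase_continuous (z : ℂ) :
    Continuous fun x : ℝ => Complex.exp (((mom z * (x - pos z / 2) : ℝ) : ℂ) * Complex.I) := by
  fun_prop

theorem translate_mp (z : ℂ) :
    MeasurePreserving (fun x : ℝ => x - pos z) volume volume :=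
  measurePreserving_sub_right volume (pos z)

theorem displaceFun_aesm (z : ℂ) {φ : ℝ → ℂ} (hφ : AEStronglyMeasurable φ volume) :
    AEStronglyMeasurable (displaceFun z φ) volume :=
  (phase_continuous z).aestronglyMeasurable.mul
    (hφ.comp_measurePreserving (translate_mp z))

theorem displaceFun_eLpNorm (z : ℂ) {φ : ℝ → ℂ} (hφ : AEStronglyMeasurable φ volume) :
    eLpNorm (displaceFun z φ) 2 volume = eLpNorm φ 2 volume := by
  rw [← eLpNorm_comp_measurePreserving hφ (translate_mp z)]
  refine eLpNorm_congr_norm_ae (Eventually.of_forall fun x => ?_)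
  simp only [displaceFun, norm_mul, Complex.norm_exp_ofReal_mul_I, one_mul, Function.comp]

theorem displaceFun_memLp (z : ℂ) {φ : ℝ → ℂ} (hφ : MemLp φ 2 volume) :
    MemLp (displaceFun z φ) 2 volume :=
  ⟨displaceFun_aesm z hφ.1, by rw [displaceFun_eLpNorm z hφ.1]; exact hφ.2⟩

theorem displaceFun_congr (z : ℂ) {φ ψ : ℝ → ℂ} (h : φ =ᵐ[volume] ψ) :
    displaceFun z φ =ᵐ[volume] displaceFun z ψ := by
  have h' := (translate_mp z).quasiMeasurePreserving.ae_eq_comp h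
  filter_upwards [h'] with x hx
  simp only [Function.comp] at hx
  simp only [displaceFun, hx]

/-- The displacement operator `D(z) = exp (z a† - z̄ a)` in the Schrödinger representation,
as an isometry: `(D(z) φ)(x) = e^{i p (x - q/2)} φ(x - q)` with `z = (q + i p) / √2`. -/
def displacementIsometry (z : ℂ) : H →ₗᵢ[ℂ] H where
  toFun φ := (displaceFun_memLp z (Lp.memLp φ)).toLp _
  map_add' φ ψ := by
    rw [← MemLp.toLp_add]
    refine MemLp.toLp_congr _ _ ?_
    refine (displaceFun_congr z (Lp.coeFn_add φ ψ)).trans (Eventually.of_forall fun x => ?_)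
    simp only [displaceFun, Pi.add_apply, mul_add]
  map_smul' c φ := by
    rw [RingHom.id_apply, ← MemLp.toLp_const_smul]
    refine MemLp.toLp_congr _ _ ?_
    refine (displaceFun_congr z (Lp.coeFn_smul c φ)).trans (Eventually.of_forall fun x => ?_)
    simp only [displaceFun, Pi.smul_apply, smul_eq_mul]
    ring
  norm_map' φ := by
    change ‖(displaceFun_memLp z (Lp.memLp φ)).toLp _‖ = ‖φ‖
    rw [Lp.norm_toLp, displaceFun_eLpNorm z (Lp.memLp φ).1, Lp.norm_def]

/-- The displacement operator `D(z)` as a bounded operator. -/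
def D (z : ℂ) : H →L[ℂ] H := (displacementIsometry z).toContinuousLinearMap

theorem D_coeFn (z : ℂ) (φ : H) :
    (D z φ : ℝ → ℂ) =ᵐ[volume] displaceFun z φ :=
  MemLp.coeFn_toLp (displaceFun_memLp z (Lp.memLp φ))

/-- The displaced operator `M(z) = D(z) M D(z)†`. -/
def displaced (M : H →L[ℂ] H) (z : ℂ) : H →L[ℂ] H :=
  D z ∘L M ∘L ContinuousLinearMap.adjoint (D z)

/-- The weight function `ϖ` defines the bounded operator `M = ∫ ϖ(z) D(z) d²z/π`, the integral
being understood weakly, as a sesquilinear form on a dense subspace which is invariant under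
the displacement operators. -/
def IsWeightIntegral (ϖ : ℂ → ℂ) (M : H →L[ℂ] H) : Prop :=
  ∃ V : Submodule ℂ H, Dense (V : Set H) ∧ (∀ z, ∀ φ ∈ V, D z φ ∈ V) ∧
    ∀ φ ∈ V, ∀ ψ ∈ V,
      Integrable (fun z => ϖ z * ⟪φ, D z ψ⟫_ℂ) phaseMeasure ∧
      ⟪φ, M ψ⟫_ℂ = ∫ z, ϖ z * ⟪φ, D z ψ⟫_ℂ ∂phaseMeasure

/-- `A` is the quantization `A_f = ∫ f(z) M(z) d²z/π` of `f`, as an absolutely convergent weak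
integral. -/
def IsQuantization (M : H →L[ℂ] H) (f : ℂ → ℂ) (A : H →L[ℂ] H) : Prop :=
  ∀ φ ψ : H,
    Integrable (fun z => f z * ⟪φ, displaced M z ψ⟫_ℂ) phaseMeasure ∧
    ⟪φ, A ψ⟫_ℂ = ∫ z, f z * ⟪φ, displaced M z ψ⟫_ℂ ∂phaseMeasure

/-- The operator `A_f` is determined by `f`. -/
theorem IsQuantization.unique {M : H →L[ℂ] H} {f : ℂ → ℂ} {A B : H →L[ℂ] H}
    (hA : IsQuantization M f A) (hB : IsQuantization M f B) : A = B := by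
  ext1 ψ
  refine ext_inner_left ℂ fun φ => ?_
  rw [(hA φ ψ).2, (hB φ ψ).2]

/-- The operator `T` has trace `t`: `∑ₙ ⟨bₙ, T bₙ⟩` converges (unconditionally) to `t` for every
orthonormal basis `b`. -/
def HasTrace (T : H →L[ℂ] H) (t : ℂ) : Prop :=
  ∀ b : HilbertBasis ℕ ℂ H, HasSum (fun n => ⟪b n, T (b n)⟫_ℂ) t

/-- Hilbert–Schmidt operators: `tr (A† A) < ∞`. -/
def IsHilbertSchmidt (A : H →L[ℂ] H) : Prop :=
  ∃ t : ℂ, HasTrace (ContinuousLinearMap.adjoint A ∘L A) t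

/-- Trace class operators: products of two Hilbert–Schmidt operators. -/
def IsTraceClass (A : H →L[ℂ] H) : Prop :=
  ∃ B C : H →L[ℂ] H, IsHilbertSchmidt B ∧ IsHilbertSchmidt C ∧ A = B ∘L C

/-- Every function `f` of the class `S` has a quantization `A_f`, and
`tr (A_f† A_f) = ∫ |f(z)|² d²z/π`. -/
def IsometricOn (M : H →L[ℂ] H) (S : Set (ℂ → ℂ)) : Prop :=
  ∀ f ∈ S, ∃ A : H →L[ℂ] H, IsQuantization M f A ∧
    HasTrace (ContinuousLinearMap.adjoint A ∘L A) ((∫ z, ‖f z‖ ^ 2 ∂phaseMeasure : ℝ) : ℂ)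

/-- `L²(ℂ, d²z/π)`. -/
def squareIntegrable : Set (ℂ → ℂ) := {f | MemLp f 2 phaseMeasure}

/-- `L¹ ∩ L²` for the measure `d²z/π`; on this class the quantization is defined for every
bounded `M`. -/
def integrableSquareIntegrable : Set (ℂ → ℂ) :=
  {f | MemLp f 1 phaseMeasure ∧ MemLp f 2 phaseMeasure}

/-- The quantization `f ↦ A_f` maps `L²(ℂ, d²z/π)` (modulo null functions) bijectively onto
the Hilbert–Schmidt operators. -/
def IsInvertible (M : H →L[ℂ] H) : Prop :=
  (∀ f ∈ squareIntegrable, ∃ A, IsQuantization M f A ∧ IsHilbertSchmidt A) ∧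
  (∀ A, IsHilbertSchmidt A → ∃ f ∈ squareIntegrable, IsQuantization M f A) ∧
  (∀ f ∈ squareIntegrable, ∀ g ∈ squareIntegrable, ∀ A,
    IsQuantization M f A → IsQuantization M g A → f =ᵐ[phaseMeasure] g)

/-- The inverse of `f ↦ A_f` is `A ↦ W`, `W(z) = tr (D(z) N D(z)† A)`.  For a trace class
operator `A` the trace exists at every `z`; for a general Hilbert–Schmidt operator the series
`∑ₙ ⟨bₙ, D(z) N D(z)† A bₙ⟩` converges to `W` in `L²(ℂ, d²z/π)`, for each orthonormal basis. -/
def InverseIsTrace (M N : H →L[ℂ] H) : Prop :=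
  ∀ A : H →L[ℂ] H, IsHilbertSchmidt A →
    ∃ W ∈ squareIntegrable,
      IsQuantization M W A ∧
      (∀ f ∈ squareIntegrable, IsQuantization M f A → f =ᵐ[phaseMeasure] W) ∧
      (∀ b : HilbertBasis ℕ ℂ H,
        Tendsto (fun s : Finset ℕ =>
          eLpNorm (fun z => (∑ n ∈ s, ⟪b n, (displaced N z ∘L A) (b n)⟫_ℂ) - W z) 2 phaseMeasure)
          atTop (𝓝 0)) ∧
      (IsTraceClass A → ∀ z, HasTrace (displaced N z ∘L A) (W z))

/-- Regular weight functions: even and real valued. -/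
def IsRegularWeight (ϖ : ℂ → ℂ) : Prop :=
  (∀ z, ϖ (-z) = ϖ z) ∧ ∀ z, starRingEnd ℂ (ϖ z) = ϖ z

end WeylHeisenberg

end

open WeylHeisenberg

/-! Conjugating `D w` by `D z` only multiplies it by a character in `w` (`inner_D_conj`), so `z ↦
⟪φ, displaced M z ψ⟫` is the symplectic Fourier transform of `w ↦ ϖ w * ⟪φ, D w ψ⟫`
(`inner_displaced_eq_fourier`). The matrix elements of `D` satisfy the orthogonality relations
(`moyal`) and are total in L². A unimodular `ϖ` does not change L² norms and the symplectic Fourier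
transform is unitary, so the operators `displaced M z` inherit both properties
(`isMoyalFrame_displaced`).

These two properties, collected in `IsMoyalFrame`, give the rest abstractly: the matrix elements
along an orthonormal basis of `H` form an orthonormal basis of L², so `f ↦ A_f` is unitary onto the
Hilbert–Schmidt operators, and the trace formula is the expansion of the symbol in that basis.

Conversely, let quantization be isometric on L¹ ∩ L², and let `f` have Schwartz symplectic Fourier
transform `k`. Then `A_f` is Hilbert–Schmidt, and its symbol with respect to the frame `D` must be
`k * ϖ`. Hence `k * ϖ` and `k` have equal L² norms for every `k` (`memLp_mul_weight`), which forces
`‖ϖ‖ = 1` almost everywhere. -/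

noncomputable section

namespace WeylHeisenberg

/-! ### Moyal frames and the Hilbert–Schmidt correspondence. -/

/-- A family of bounded operators on `H`, indexed by the phase space, whose matrix elements satisfy
the orthogonality relations and are total in `L²(ℂ, d²z/π)`. -/
structure IsMoyalFrame (N : ℂ → H →L[ℂ] H) : Prop where
  memLp (φ ψ : H) : MemLp (fun z => ⟪N z ψ, φ⟫_ℂ) 2 phaseMeasure
  eLpNorm_eq (φ ψ : H) :
    eLpNorm (fun z => ⟪N z ψ, φ⟫_ℂ) 2 phaseMeasure = ENNReal.ofReal (‖φ‖ * ‖ψ‖)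
  eq_zero (f : ℂ → ℂ) (hf : MemLp f 2 phaseMeasure)
    (h : ∀ φ ψ, ∫ z, f z * ⟪φ, N z ψ⟫_ℂ ∂phaseMeasure = 0) : f =ᵐ[phaseMeasure] 0

namespace IsMoyalFrame

variable {N : ℂ → H →L[ℂ] H}

/-- The function `z ↦ ⟪N z ψ, φ⟫`, as an element of `L²(ℂ, d²z/π)`. -/
def coeff (hN : IsMoyalFrame N) (φ ψ : H) : Lp ℂ 2 phaseMeasure := (hN.memLp φ ψ).toLp _

theorem coeff_coeFn (hN : IsMoyalFrame N) (φ ψ : H) :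
    hN.coeff φ ψ =ᵐ[phaseMeasure] fun z => ⟪N z ψ, φ⟫_ℂ :=
  MemLp.coeFn_toLp _

theorem coeff_add_left (hN : IsMoyalFrame N) (φ₁ φ₂ ψ : H) :
    hN.coeff (φ₁ + φ₂) ψ = hN.coeff φ₁ ψ + hN.coeff φ₂ ψ := by
  rw [coeff, coeff, coeff, ← MemLp.toLp_add]
  exact MemLp.toLp_congr _ _ (Eventually.of_forall fun z => by simp [inner_add_right])

theorem coeff_smul_left (hN : IsMoyalFrame N) (c : ℂ) (φ ψ : H) :
    hN.coeff (c • φ) ψ = c • hN.coeff φ ψ := by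
  rw [coeff, coeff, ← MemLp.toLp_const_smul]
  exact MemLp.toLp_congr _ _ (Eventually.of_forall fun z => by simp [inner_smul_right])

theorem coeff_add_right (hN : IsMoyalFrame N) (φ ψ₁ ψ₂ : H) :
    hN.coeff φ (ψ₁ + ψ₂) = hN.coeff φ ψ₁ + hN.coeff φ ψ₂ := by
  rw [coeff, coeff, coeff, ← MemLp.toLp_add]
  exact MemLp.toLp_congr _ _ (Eventually.of_forall fun z => by simp [inner_add_left])

theorem coeff_smul_right (hN : IsMoyalFrame N) (c : ℂ) (φ ψ : H) :
    hN.coeff φ (c • ψ) = starRingEnd ℂ c • hN.coeff φ ψ := by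
  rw [coeff, coeff, ← MemLp.toLp_const_smul]
  exact MemLp.toLp_congr _ _ (Eventually.of_forall fun z => by simp [inner_smul_left])

theorem norm_coeff (hN : IsMoyalFrame N) (φ ψ : H) : ‖hN.coeff φ ψ‖ = ‖φ‖ * ‖ψ‖ := by
  rw [coeff, Lp.norm_toLp, hN.eLpNorm_eq, ENNReal.toReal_ofReal (by positivity)]

/-- `φ ↦ coeff φ ψ` as a bounded linear map. -/
def coeffCLM (hN : IsMoyalFrame N) (ψ : H) : H →L[ℂ] Lp ℂ 2 phaseMeasure :=
  LinearMap.mkContinuous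
    { toFun := fun φ => hN.coeff φ ψ
      map_add' := fun φ₁ φ₂ => hN.coeff_add_left φ₁ φ₂ ψ
      map_smul' := fun c φ => hN.coeff_smul_left c φ ψ } ‖ψ‖
    fun φ => by simp [norm_coeff, mul_comm]

@[simp]
theorem coeffCLM_apply (hN : IsMoyalFrame N) (φ ψ : H) : hN.coeffCLM ψ φ = hN.coeff φ ψ := rfl

theorem inner_coeff_self_right (hN : IsMoyalFrame N) (φ₁ φ₂ ψ : H) :
    ⟪hN.coeff φ₁ ψ, hN.coeff φ₂ ψ⟫_ℂ = ⟪φ₁, φ₂⟫_ℂ * ⟪ψ, ψ⟫_ℂ := by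
  have h : ∀ φ, ‖hN.coeffCLM ψ φ‖ = ‖φ‖ * ‖ψ‖ := fun φ => hN.norm_coeff φ ψ
  rw [← coeffCLM_apply, ← coeffCLM_apply, inner_eq_sum_norm_sq_div_four, ← map_add, ← map_sub,
    ← map_smul, ← map_sub, ← map_add, h, h, h, h, inner_eq_sum_norm_sq_div_four φ₁ φ₂,
    inner_self_eq_norm_sq_to_K]
  push_cast
  simp only [Complex.coe_algebraMap]
  ring

/-- The orthogonality relations. -/
theorem inner_coeff (hN : IsMoyalFrame N) (φ₁ ψ₁ φ₂ ψ₂ : H) :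
    ⟪hN.coeff φ₁ ψ₁, hN.coeff φ₂ ψ₂⟫_ℂ = ⟪φ₁, φ₂⟫_ℂ * ⟪ψ₂, ψ₁⟫_ℂ := by
  -- Polarization in `ψ`, where `coeff` is antilinear: `ψ₁ + ψ₂` yields the sum of the two cross
  -- terms, `ψ₁ + i ψ₂` their difference.
  have h₁ := hN.inner_coeff_self_right φ₁ φ₂ (ψ₁ + ψ₂)
  have h₂ := hN.inner_coeff_self_right φ₁ φ₂ (ψ₁ + Complex.I • ψ₂)
  have h₃ := hN.inner_coeff_self_right φ₁ φ₂ ψ₁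
  have h₄ := hN.inner_coeff_self_right φ₁ φ₂ ψ₂
  simp only [coeff_add_right, coeff_smul_right, inner_add_left, inner_add_right, inner_smul_left,
    inner_smul_right, Complex.conj_I, h₃, h₄, map_neg] at h₁ h₂
  linear_combination (1 / 2 : ℂ) * h₁ + (Complex.I / 2) * h₂ + (1 / 2 : ℂ) *
    (⟪hN.coeff φ₁ ψ₁, hN.coeff φ₂ ψ₂⟫_ℂ - ⟪hN.coeff φ₁ ψ₂, hN.coeff φ₂ ψ₁⟫_ℂ
      - ⟪φ₁, φ₂⟫_ℂ * ⟪ψ₂, ψ₁⟫_ℂ + ⟪φ₁, φ₂⟫_ℂ * ⟪ψ₁, ψ₂⟫_ℂ) * Complex.I_sq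

theorem inner_coeff_eq_integral (hN : IsMoyalFrame N) (φ ψ : H) (f : Lp ℂ 2 phaseMeasure) :
    ⟪hN.coeff φ ψ, f⟫_ℂ = ∫ z, f z * ⟪φ, N z ψ⟫_ℂ ∂phaseMeasure := by
  rw [L2.inner_def]
  refine integral_congr_ae ?_
  filter_upwards [hN.coeff_coeFn φ ψ] with z hz
  rw [hz, RCLike.inner_apply, inner_conj_symm]

theorem integrable_mul_inner (hN : IsMoyalFrame N) {f : ℂ → ℂ} (hf : MemLp f 2 phaseMeasure)
    (φ ψ : H) : Integrable (fun z => f z * ⟪φ, N z ψ⟫_ℂ) phaseMeasure := by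
  refine (hf.integrable_mul ((hN.memLp φ ψ).star)).congr (Eventually.of_forall fun z => ?_)
  simp [inner_conj_symm]

theorem eq_zero_of_inner_coeff (hN : IsMoyalFrame N) (f : Lp ℂ 2 phaseMeasure)
    (h : ∀ φ ψ, ⟪hN.coeff φ ψ, f⟫_ℂ = 0) : f = 0 := by
  rw [Lp.eq_zero_iff_ae_eq_zero]
  exact hN.eq_zero f (Lp.memLp f) fun φ ψ => by
    rw [← hN.inner_coeff_eq_integral, h]

/-- `(φ, ψ) ↦ ⟪coeff φ ψ, f⟫` as a bounded sesquilinear form. -/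
def form (hN : IsMoyalFrame N) (f : Lp ℂ 2 phaseMeasure) : H →L⋆[ℂ] H →L[ℂ] ℂ :=
  LinearMap.mkContinuous₂
    (LinearMap.mk₂'ₛₗ (starRingEnd ℂ) (RingHom.id ℂ) (fun φ ψ => ⟪hN.coeff φ ψ, f⟫_ℂ)
      (fun φ₁ φ₂ ψ => by rw [hN.coeff_add_left, inner_add_left])
      (fun c φ ψ => by rw [hN.coeff_smul_left, inner_smul_left, smul_eq_mul])
      (fun φ ψ₁ ψ₂ => by rw [hN.coeff_add_right, inner_add_left])
      (fun c φ ψ => by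
        rw [hN.coeff_smul_right, inner_smul_left, Complex.conj_conj, RingHom.id_apply,
          smul_eq_mul]))
    ‖f‖ fun φ ψ => by
      change ‖⟪hN.coeff φ ψ, f⟫_ℂ‖ ≤ _
      refine (norm_inner_le_norm _ _).trans (le_of_eq ?_)
      rw [norm_coeff]
      ring

/-- The operator `∫ f(z) N(z) d²z/π`. -/
def op (hN : IsMoyalFrame N) (f : Lp ℂ 2 phaseMeasure) : H →L[ℂ] H :=
  -- The operator representing the form acts on the first argument `φ`; the adjoint moves it to `ψ`.
  ContinuousLinearMap.adjoint (InnerProductSpace.continuousLinearMapOfBilin (hN.form f))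

theorem inner_op (hN : IsMoyalFrame N) (f : Lp ℂ 2 phaseMeasure) (φ ψ : H) :
    ⟪φ, hN.op f ψ⟫_ℂ = ⟪hN.coeff φ ψ, f⟫_ℂ := by
  rw [op, ContinuousLinearMap.adjoint_inner_right,
    InnerProductSpace.continuousLinearMapOfBilin_apply]
  rfl

theorem ext_op_iff (hN : IsMoyalFrame N) (f : Lp ℂ 2 phaseMeasure) (A : H →L[ℂ] H) :
    A = hN.op f ↔ ∀ φ ψ, ⟪φ, A ψ⟫_ℂ = ⟪hN.coeff φ ψ, f⟫_ℂ := by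
  refine ⟨fun h φ ψ => by rw [h, inner_op], fun h => ?_⟩
  ext1 ψ
  exact ext_inner_left ℂ fun φ => by rw [h, inner_op]

theorem op_injective (hN : IsMoyalFrame N) : Function.Injective hN.op := fun f g h => by
  rw [← sub_eq_zero]
  refine hN.eq_zero_of_inner_coeff _ fun φ ψ => ?_
  rw [inner_sub_right, ← inner_op, ← inner_op, h, sub_self]

theorem orthonormal_coeff (hN : IsMoyalFrame N) (b : HilbertBasis ℕ ℂ H) :
    Orthonormal ℂ fun p : ℕ × ℕ => hN.coeff (b p.1) (b p.2) := by
  classical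
  rw [orthonormal_iff_ite]
  rintro ⟨m, n⟩ ⟨m', n'⟩
  have h := orthonormal_iff_ite.1 b.orthonormal
  rw [inner_coeff, h, h]
  by_cases hm : m = m' <;> by_cases hn : n = n' <;> simp [hm, hn, eq_comm (a := n')]

theorem ext_of_basis (b : HilbertBasis ℕ ℂ H) {A B : H →L[ℂ] H}
    (h : ∀ m n, ⟪b m, A (b n)⟫_ℂ = ⟪b m, B (b n)⟫_ℂ) : A = B := by
  refine ContinuousLinearMap.ext_on (s := Set.range b) ?_ ?_
  · exact Submodule.dense_iff_topologicalClosure_eq_top.2 b.dense_span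
  · rintro _ ⟨n, rfl⟩
    refine b.repr.injective ?_
    ext m
    rw [b.repr_apply_apply, b.repr_apply_apply, h]

theorem hasSum_norm_inner_sq (b : HilbertBasis ℕ ℂ H) (φ : H) :
    HasSum (fun n => ‖⟪b n, φ⟫_ℂ‖ ^ 2) (‖φ‖ ^ 2) := by
  have h := b.hasSum_inner_mul_inner φ φ
  rw [inner_self_eq_norm_sq_to_K] at h
  rw [← Complex.hasSum_ofReal]
  push_cast
  refine h.congr_fun fun n => ?_
  rw [← inner_conj_symm φ, Complex.conj_mul']

/-- The orthonormal basis of `L²(ℂ, d²z/π)` given by the matrix elements with respect to an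
orthonormal basis of `H`. -/
def basis (hN : IsMoyalFrame N) (b : HilbertBasis ℕ ℂ H) :
    HilbertBasis (ℕ × ℕ) ℂ (Lp ℂ 2 phaseMeasure) :=
  HilbertBasis.mkOfOrthogonalEqBot (hN.orthonormal_coeff b) <| by
    rw [Submodule.eq_bot_iff]
    intro f hf
    -- A function orthogonal to all basis matrix elements yields an operator with zero matrix;
    -- totality, in the form of injectivity of `op`, then makes it zero.
    apply hN.op_injective
    refine ext_of_basis b fun m n => ?_
    rw [inner_op, inner_op, inner_zero_right]
    exact (Submodule.mem_orthogonal _ _).1 hf _ (Submodule.subset_span ⟨(m, n), rfl⟩)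

@[simp]
theorem basis_apply (hN : IsMoyalFrame N) (b : HilbertBasis ℕ ℂ H) (p : ℕ × ℕ) :
    hN.basis b p = hN.coeff (b p.1) (b p.2) := by
  rw [basis, HilbertBasis.coe_mkOfOrthogonalEqBot]

/-- The Hilbert–Schmidt inner product of `op f` and `op g`. -/
theorem hasSum_inner_op (hN : IsMoyalFrame N) (b : HilbertBasis ℕ ℂ H)
    (f g : Lp ℂ 2 phaseMeasure) :
    HasSum (fun n => ⟪hN.op f (b n), hN.op g (b n)⟫_ℂ) ⟪f, g⟫_ℂ := by
  have h := (hN.basis b).hasSum_inner_mul_inner f g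
  -- Parseval over pairs `(m, n)`, regrouped by the column `n`: the inner sum over `m` is Parseval
  -- in `H`.
  rw [← (Equiv.prodComm ℕ ℕ).hasSum_iff] at h
  refine h.prod_fiberwise fun n => ?_
  convert b.hasSum_inner_mul_inner (hN.op f (b n)) (hN.op g (b n)) using 2 with m
  rw [← inner_conj_symm (hN.op f (b n)), inner_op, inner_op, inner_conj_symm]
  simp

/-- An operator whose matrix elements are square summable comes from a function. -/
theorem exists_op_eq (hN : IsMoyalFrame N) (b : HilbertBasis ℕ ℂ H) (A : H →L[ℂ] H)
    (hA : Summable fun n => ‖A (b n)‖ ^ 2) : ∃ f, A = hN.op f := by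
  have h₁ : ∀ n, HasSum (fun m => ‖⟪b m, A (b n)⟫_ℂ‖ ^ 2) (‖A (b n)‖ ^ 2) := fun n =>
    hasSum_norm_inner_sq b _
  have h₂ : Summable fun p : ℕ × ℕ => ‖⟪b p.1, A (b p.2)⟫_ℂ‖ ^ 2 := by
    rw [← (Equiv.prodComm ℕ ℕ).summable_iff]
    refine (summable_prod_of_nonneg fun p => sq_nonneg _).2 ⟨fun n => (h₁ n).summable, ?_⟩
    exact hA.congr fun n => (h₁ n).tsum_eq.symm
  have h₃ : Memℓp (fun p : ℕ × ℕ => ⟪b p.1, A (b p.2)⟫_ℂ) 2 :=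
    memℓp_gen (by simpa using h₂)
  refine ⟨(hN.basis b).repr.symm ⟨_, h₃⟩, ext_of_basis b fun m n => ?_⟩
  rw [inner_op]
  change _ = ⟪hN.coeff (b (m, n).1) (b (m, n).2), _⟫_ℂ
  rw [← hN.basis_apply b (m, n), ← (hN.basis b).repr_apply_apply,
    LinearIsometryEquiv.apply_symm_apply]

theorem hasTrace_adjoint_comp_op (hN : IsMoyalFrame N) (f g : Lp ℂ 2 phaseMeasure) :
    HasTrace (ContinuousLinearMap.adjoint (hN.op f) ∘L hN.op g) ⟪f, g⟫_ℂ := fun b => by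
  simpa [ContinuousLinearMap.adjoint_inner_right] using hN.hasSum_inner_op b f g

theorem isHilbertSchmidt_op (hN : IsMoyalFrame N) (f : Lp ℂ 2 phaseMeasure) :
    IsHilbertSchmidt (hN.op f) :=
  ⟨_, hN.hasTrace_adjoint_comp_op f f⟩

/-- `HasTrace` demands the same sum in every basis. Summability in one basis suffices because it
produces a symbol, whose L² norm does not depend on the basis. -/
theorem isHilbertSchmidt_iff_summable (hN : IsMoyalFrame N) (b : HilbertBasis ℕ ℂ H)
    (A : H →L[ℂ] H) : IsHilbertSchmidt A ↔ Summable fun n => ‖A (b n)‖ ^ 2 := by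
  refine ⟨fun ⟨t, ht⟩ => ?_, fun h => ?_⟩
  · have := (Complex.hasSum_re (ht b)).summable
    refine this.congr fun n => ?_
    simp only [ContinuousLinearMap.comp_apply, ContinuousLinearMap.adjoint_inner_right]
    exact inner_self_eq_norm_sq (𝕜 := ℂ) _
  · obtain ⟨f, rfl⟩ := hN.exists_op_eq b A h
    exact hN.isHilbertSchmidt_op f

theorem isHilbertSchmidt_comp (hN : IsMoyalFrame N) (b : HilbertBasis ℕ ℂ H) {A : H →L[ℂ] H}
    (hA : IsHilbertSchmidt A) (X : H →L[ℂ] H) : IsHilbertSchmidt (X ∘L A) := by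
  rw [hN.isHilbertSchmidt_iff_summable b] at hA ⊢
  refine (hA.mul_left (‖X‖ ^ 2)).of_nonneg_of_le (fun n => by positivity) fun n => ?_
  rw [← mul_pow]
  gcongr
  exact X.le_opNorm _

theorem isHilbertSchmidt_adjoint (hN : IsMoyalFrame N) (b : HilbertBasis ℕ ℂ H) {A : H →L[ℂ] H}
    (hA : IsHilbertSchmidt A) : IsHilbertSchmidt (ContinuousLinearMap.adjoint A) := by
  rw [hN.isHilbertSchmidt_iff_summable b] at hA ⊢
  -- The squared matrix entries are summable over pairs, and transposing the pairs passes to the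
  -- adjoint.
  have h₂ : Summable fun p : ℕ × ℕ => ‖⟪b p.2, A (b p.1)⟫_ℂ‖ ^ 2 :=
    (summable_prod_of_nonneg fun p => sq_nonneg _).2
      ⟨fun n => (hasSum_norm_inner_sq b (A (b n))).summable,
        hA.congr fun n => (hasSum_norm_inner_sq b (A (b n))).tsum_eq.symm⟩
  rw [← (Equiv.prodComm ℕ ℕ).summable_iff] at h₂
  refine ((summable_prod_of_nonneg fun p => sq_nonneg _).1 h₂).2.congr fun n => ?_
  rw [← (hasSum_norm_inner_sq b _).tsum_eq]
  refine tsum_congr fun m => ?_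
  simp only [Equiv.prodComm_apply, Prod.swap]
  rw [ContinuousLinearMap.adjoint_inner_right, norm_inner_symm]

/-- The trace of a trace class operator times a bounded operator exists. -/
theorem exists_hasTrace_comp (hN : IsMoyalFrame N) (b : HilbertBasis ℕ ℂ H) {A : H →L[ℂ] H}
    (hA : IsTraceClass A) (X : H →L[ℂ] H) : ∃ t, HasTrace (X ∘L A) t := by
  obtain ⟨B, C, hB, hC, rfl⟩ := hA
  -- The trace of `X B C` is the Hilbert–Schmidt inner product of `(X B)†` with `C`.
  have hB' := hN.isHilbertSchmidt_adjoint b (hN.isHilbertSchmidt_comp b hB X)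
  rw [hN.isHilbertSchmidt_iff_summable b] at hB' hC
  obtain ⟨f, hf⟩ := hN.exists_op_eq b _ hB'
  obtain ⟨g, hg⟩ := hN.exists_op_eq b _ hC
  refine ⟨⟪f, g⟫_ℂ, ?_⟩
  have := hN.hasTrace_adjoint_comp_op f g
  rwa [← hf, ← hg, ContinuousLinearMap.adjoint_adjoint] at this

/-- The expansion of the symbol of an operator along an orthonormal basis. -/
theorem hasSum_coeff_op (hN : IsMoyalFrame N) (b : HilbertBasis ℕ ℂ H)
    (f : Lp ℂ 2 phaseMeasure) : HasSum (fun n => hN.coeff (hN.op f (b n)) (b n)) f := by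
  have h := (hN.basis b).hasSum_repr f
  rw [← (Equiv.prodComm ℕ ℕ).hasSum_iff] at h
  refine h.prod_fiberwise fun n => ?_
  convert (b.hasSum_repr (hN.op f (b n))).mapL (hN.coeffCLM (b n)) using 2 with m
  · simp [HilbertBasis.repr_apply_apply, inner_op]
  · rfl

/-- A function on phase space is quantized by `op`. -/
theorem isQuantization_iff (hM : IsMoyalFrame N) {f : ℂ → ℂ} (hf : MemLp f 2 phaseMeasure)
    (A : H →L[ℂ] H) :
    (∀ φ ψ : H, Integrable (fun z => f z * ⟪φ, N z ψ⟫_ℂ) phaseMeasure ∧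
      ⟪φ, A ψ⟫_ℂ = ∫ z, f z * ⟪φ, N z ψ⟫_ℂ ∂phaseMeasure) ↔ A = hM.op (hf.toLp f) := by
  have h : ∀ φ ψ, ⟪hM.coeff φ ψ, hf.toLp f⟫_ℂ = ∫ z, f z * ⟪φ, N z ψ⟫_ℂ ∂phaseMeasure := by
    intro φ ψ
    rw [inner_coeff_eq_integral]
    refine integral_congr_ae ?_
    filter_upwards [hf.coeFn_toLp] with z hz
    rw [hz]
  rw [hM.ext_op_iff]
  simp only [h, hM.integrable_mul_inner hf, true_and]

end IsMoyalFrame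

/-! ### A countably infinite orthonormal basis of `H`. -/

theorem Orthonormal.countable_of_separable {E : Type*} [NormedAddCommGroup E]
    [InnerProductSpace ℂ E] [TopologicalSpace.SeparableSpace E] {s : Set E}
    (hs : Orthonormal ℂ ((↑) : s → E)) : s.Countable := by
  have h : ∀ x ∈ s, ∀ y ∈ s, x ≠ y → 1 ≤ dist x y := by
    intro x hx y hy hxy
    have h₁ : ⟪x, y⟫_ℂ = 0 :=
      hs.2 (i := ⟨x, hx⟩) (j := ⟨y, hy⟩) fun e => hxy (congrArg Subtype.val e)
    have h₂ := @norm_sub_sq ℂ _ _ _ _ x y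
    have h₃ : ‖x‖ = 1 := hs.1 ⟨x, hx⟩
    have h₄ : ‖y‖ = 1 := hs.1 ⟨y, hy⟩
    rw [h₁, h₃, h₄, map_zero] at h₂
    rw [dist_eq_norm]
    nlinarith [norm_nonneg (x - y)]
  refine Set.PairwiseDisjoint.countable_of_isOpen (s := fun x => Metric.ball x (1 / 2))
    (fun x hx y hy hxy => Metric.ball_disjoint_ball ?_) (fun _ _ => Metric.isOpen_ball)
    fun x _ => ⟨x, Metric.mem_ball_self (by norm_num)⟩
  have := h x hx y hy hxy
  linarith

/-- `L²(ℝ)` is infinite-dimensional: the indicator functions of the intervals `(n, n + 1]` are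
orthonormal. -/
theorem not_finiteDimensional_H : ¬ FiniteDimensional ℂ H := by
  intro h
  have hμ : ∀ n : ℕ, volume (Set.Ioc (n : ℝ) (n + 1)) ≠ ∞ := fun n => by simp
  have ho : Orthonormal ℂ fun n : ℕ =>
      (indicatorConstLp 2 measurableSet_Ioc (hμ n) (1 : ℂ) : H) := by
    rw [orthonormal_iff_ite]
    intro m n
    rw [L2.inner_indicatorConstLp_one_indicatorConstLp_one measurableSet_Ioc measurableSet_Ioc
      (hμ m) (hμ n)]
    split_ifs with h
    · subst h
      simp [Measure.real]
    · have hd : Set.Ioc (m : ℝ) (m + 1) ∩ Set.Ioc (n : ℝ) (n + 1) = ∅ := by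
        refine Set.disjoint_iff_inter_eq_empty.1 ?_
        simpa using Set.pairwise_disjoint_Ioc_intCast ℝ (i := (m : ℤ)) (j := (n : ℤ))
          (by simpa using h)
      simp [hd]
  exact not_finite_iff_infinite.2 (inferInstance : Infinite ℕ) ho.linearIndependent.finite

/-- Ensures that `HasTrace`, which quantifies over bases indexed by ℕ, is not vacuous. -/
theorem exists_hilbertBasis_nat : Nonempty (HilbertBasis ℕ ℂ H) := by
  obtain ⟨w, b, hb⟩ := exists_hilbertBasis ℂ H
  have : Fact ((2 : ℝ≥0∞) ≠ ∞) := ⟨by norm_num⟩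
  have ho : Orthonormal ℂ ((↑) : w → H) := hb ▸ b.orthonormal
  have hc : Countable w := (Orthonormal.countable_of_separable ho).to_subtype
  have hi : Infinite w := by
    by_contra hf
    rw [not_infinite_iff_finite] at hf
    have := Fintype.ofFinite w
    exact not_finiteDimensional_H (b.toOrthonormalBasis.toBasis.finiteDimensional_of_finite)
  obtain ⟨e⟩ := nonempty_equiv_of_countable (α := w) (β := ℕ)
  refine ⟨HilbertBasis.mk (v := b ∘ e.symm) (b.orthonormal.comp _ e.symm.injective) ?_⟩
  rw [e.symm.surjective.range_comp, b.dense_span]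

/-! ### Isometry, bijectivity and trace inversion from the frame property. -/

theorem adjoint_displaced (M : H →L[ℂ] H) (z : ℂ) :
    displaced (ContinuousLinearMap.adjoint M) z = ContinuousLinearMap.adjoint (displaced M z) := by
  simp [displaced, ContinuousLinearMap.adjoint_comp, ContinuousLinearMap.comp_assoc]

namespace IsMoyalFrame

variable {M : H →L[ℂ] H}

theorem isQuantization_iff_eq_op (hM : IsMoyalFrame (displaced M)) {f : ℂ → ℂ}
    (hf : MemLp f 2 phaseMeasure) (A : H →L[ℂ] H) :
    IsQuantization M f A ↔ A = hM.op (hf.toLp f) :=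
  hM.isQuantization_iff hf A

theorem isometricOn (hM : IsMoyalFrame (displaced M)) : IsometricOn M squareIntegrable := by
  intro f hf
  refine ⟨_, (hM.isQuantization_iff_eq_op hf _).2 rfl, ?_⟩
  convert hM.hasTrace_adjoint_comp_op (hf.toLp f) (hf.toLp f)
  rw [L2.inner_def, ← integral_complex_ofReal]
  refine integral_congr_ae ?_
  filter_upwards [hf.coeFn_toLp] with z hz
  rw [hz, inner_self_eq_norm_sq_to_K]
  simp

theorem isInvertible (hM : IsMoyalFrame (displaced M)) : IsInvertible M := by
  obtain ⟨b⟩ := exists_hilbertBasis_nat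
  refine ⟨fun f hf => ⟨_, (hM.isQuantization_iff_eq_op hf _).2 rfl, hM.isHilbertSchmidt_op _⟩,
    fun A hA => ?_, fun f hf g hg A hfA hgA => ?_⟩
  · obtain ⟨f, rfl⟩ := hM.exists_op_eq b A ((hM.isHilbertSchmidt_iff_summable b A).1 hA)
    exact ⟨f, Lp.memLp f, (hM.isQuantization_iff_eq_op (Lp.memLp f) _).2 (by simp)⟩
  · rw [hM.isQuantization_iff_eq_op hf] at hfA
    rw [hM.isQuantization_iff_eq_op hg] at hgA
    exact (MemLp.toLp_eq_toLp_iff hf hg).1 (hM.op_injective (hfA.symm.trans hgA))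

theorem inverseIsTrace (hM : IsMoyalFrame (displaced M)) :
    InverseIsTrace M (ContinuousLinearMap.adjoint M) := by
  classical
  intro A hA
  obtain ⟨b₀⟩ := exists_hilbertBasis_nat
  obtain ⟨f, rfl⟩ := hM.exists_op_eq b₀ A ((hM.isHilbertSchmidt_iff_summable b₀ A).1 hA)
  have hsum : ∀ (b : HilbertBasis ℕ ℂ H) (s : Finset ℕ),
      (fun z => ∑ n ∈ s, ⟪b n, (displaced (ContinuousLinearMap.adjoint M) z ∘L hM.op f) (b n)⟫_ℂ)
        =ᵐ[phaseMeasure] (∑ n ∈ s, hM.coeff (hM.op f (b n)) (b n) : Lp ℂ 2 phaseMeasure) := by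
    intro b s
    refine EventuallyEq.trans ?_ (Lp.coeFn_finsetSum s _).symm
    have h : ∀ᵐ z ∂phaseMeasure, ∀ n, hM.coeff (hM.op f (b n)) (b n) z
        = ⟪displaced M z (b n), hM.op f (b n)⟫_ℂ := ae_all_iff.2 fun n => hM.coeff_coeFn _ _
    filter_upwards [h] with z hz
    simp [hz, adjoint_displaced, ContinuousLinearMap.adjoint_inner_right]
  have htend : ∀ b : HilbertBasis ℕ ℂ H, Tendsto (fun s : Finset ℕ => eLpNorm (fun z =>
      (∑ n ∈ s, ⟪b n, (displaced (ContinuousLinearMap.adjoint M) z ∘L hM.op f) (b n)⟫_ℂ) - f z) 2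
        phaseMeasure) atTop (𝓝 0) := by
    intro b
    have h := (Lp.tendsto_Lp_iff_tendsto_eLpNorm' _ _).1 (hM.hasSum_coeff_op b f)
    refine h.congr fun s => eLpNorm_congr_ae ?_
    exact (hsum b s).symm.sub EventuallyEq.rfl
  -- The trace class claim concerns every `z`, so the representative matters: `W` is then the
  -- pointwise trace. It agrees almost everywhere with the L² limit `f`, because a subsequence of
  -- the partial sums converges to `f` almost everywhere.
  have key : ∃ W : ℂ → ℂ, W =ᵐ[phaseMeasure] f ∧ (IsTraceClass (hM.op f) →
      ∀ z, HasTrace (displaced (ContinuousLinearMap.adjoint M) z ∘L hM.op f) (W z)) := by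
    by_cases hT : IsTraceClass (hM.op f)
    · choose W hW using fun z =>
        hM.exists_hasTrace_comp b₀ hT (displaced (ContinuousLinearMap.adjoint M) z)
      refine ⟨W, ?_, fun _ => hW⟩
      have h₁ := (htend b₀).comp tendsto_finset_range
      have h₂ : TendstoInMeasure phaseMeasure (fun (k : ℕ) z => ∑ n ∈ Finset.range k,
          ⟪b₀ n, (displaced (ContinuousLinearMap.adjoint M) z ∘L hM.op f) (b₀ n)⟫_ℂ) atTop f := by
        refine tendstoInMeasure_of_tendsto_eLpNorm (p := 2) (by norm_num) (fun k => ?_)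
          (Lp.aestronglyMeasurable f) h₁
        exact (Lp.aestronglyMeasurable _).congr (hsum b₀ _).symm
      obtain ⟨ns, hns, h₃⟩ := h₂.exists_seq_tendsto_ae
      filter_upwards [h₃] with z hz
      exact tendsto_nhds_unique ((hW z b₀).tendsto_sum_nat.comp hns.tendsto_atTop) hz
    · exact ⟨f, EventuallyEq.rfl, fun h => absurd h hT⟩
  obtain ⟨W, hWf, hWt⟩ := key
  have hW : MemLp W 2 phaseMeasure := (memLp_congr_ae hWf).2 (Lp.memLp f)
  have hWop : hW.toLp W = f := by
    rw [← Lp.toLp_coeFn f (Lp.memLp f)]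
    exact MemLp.toLp_congr _ _ hWf
  refine ⟨W, hW, (hM.isQuantization_iff_eq_op hW _).2 (by rw [hWop]), fun g hg hgA => ?_,
    fun b => ?_, hWt⟩
  · rw [hM.isQuantization_iff_eq_op hg] at hgA
    rw [← hWop] at hgA
    exact (MemLp.toLp_eq_toLp_iff hg hW).1 (hM.op_injective hgA).symm
  · refine (htend b).congr fun s => eLpNorm_congr_ae ?_
    exact EventuallyEq.rfl.sub hWf.symm

end IsMoyalFrame

/-! ### Injectivity and Plancherel for the Fourier integral. -/

section Fourier

open FourierTransform SchwartzMap

variable {E : Type*} [NormedAddCommGroup E] [InnerProductSpace ℝ E] [FiniteDimensional ℝ E]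
  [MeasurableSpace E] [BorelSpace E]

theorem integral_smul_fourier_eq (g : 𝓢(E, ℂ)) {h : E → ℂ} (hh : Integrable h) :
    ∫ x, g x • 𝓕 h x = ∫ x, 𝓕 g x • h x := by
  have := VectorFourier.integral_fourierIntegral_smul_eq_flip (L := innerₗ E)
    Real.continuous_fourierChar continuous_inner (g.integrable (μ := volume)) hh
  rw [flip_innerₗ] at this
  exact this.symm

/-- Every test function is the Fourier transform of a Schwartz function, and the transform can be
moved onto `h`. -/
theorem ae_eq_zero_of_fourier_eq_zero {h : E → ℂ} (hh : Integrable h) (h0 : ∀ ξ, 𝓕 h ξ = 0) :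
    h =ᵐ[volume] 0 := by
  refine ae_eq_zero_of_integral_contDiff_smul_eq_zero hh.locallyIntegrable fun g hg hgc => ?_
  have hg₁ : HasCompactSupport (Complex.ofRealCLM ∘ g) := hgc.comp_left rfl
  have hg₂ : ContDiff ℝ ((⊤ : ℕ∞) : WithTop ℕ∞) (Complex.ofRealCLM ∘ g) :=
    Complex.ofRealCLM.contDiff.comp hg
  have key := integral_smul_fourier_eq (𝓕⁻ (hg₁.toSchwartzMap hg₂)) hh
  rw [fourier_fourierInv_eq] at key
  simp only [h0, smul_zero, integral_zero] at key
  rw [key]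
  refine integral_congr_ae (Eventually.of_forall fun x => ?_)
  simp

/-- Identifies the abstract L² Fourier transform with the integral by testing both against smooth
compactly supported functions. -/
theorem fourier_toLp_ae_eq {h : E → ℂ} (h₁ : Integrable h) (h₂ : MemLp h 2) :
    (𝓕 (h₂.toLp h) : Lp ℂ 2 (volume : Measure E)) =ᵐ[volume] 𝓕 h := by
  have hc : Continuous (𝓕 h) := VectorFourier.fourierIntegral_continuous
    Real.continuous_fourierChar (by exact continuous_inner) h₁
  refine ae_eq_of_integral_contDiff_smul_eq
    ((Lp.memLp _).locallyIntegrable (by norm_num)) hc.locallyIntegrable fun g hg hgc => ?_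
  have hg₁ : HasCompactSupport (Complex.ofRealCLM ∘ g) := hgc.comp_left rfl
  have hg₂ : ContDiff ℝ ((⊤ : ℕ∞) : WithTop ℕ∞) (Complex.ofRealCLM ∘ g) :=
    Complex.ofRealCLM.contDiff.comp hg
  set G : 𝓢(E, ℂ) := hg₁.toSchwartzMap hg₂
  have hG : ∀ x, G x = g x := fun x => by simp [G]
  have key := congrArg (fun T => T G) (Lp.fourier_toTemperedDistribution_eq (h₂.toLp h))
  simp only [TemperedDistribution.fourier_apply, Lp.toTemperedDistribution_apply] at key
  calc ∫ x, g x • (𝓕 (h₂.toLp h) : Lp ℂ 2 (volume : Measure E)) x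
      = ∫ x, G x • (𝓕 (h₂.toLp h) : Lp ℂ 2 (volume : Measure E)) x := by simp [hG]
    _ = ∫ x, 𝓕 G x • h₂.toLp h x := key.symm
    _ = ∫ x, 𝓕 G x • h x := by
      refine integral_congr_ae ?_
      filter_upwards [h₂.coeFn_toLp] with x hx
      rw [hx]
    _ = ∫ x, g x • 𝓕 h x := by
      rw [← integral_smul_fourier_eq G h₁]
      simp [hG]

theorem memLp_fourier {h : E → ℂ} (h₁ : Integrable h) (h₂ : MemLp h 2) : MemLp (𝓕 h) 2 :=
  (memLp_congr_ae (fourier_toLp_ae_eq h₁ h₂)).1 (Lp.memLp _)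

/-- Plancherel's theorem for integrable square integrable functions. -/
theorem eLpNorm_fourier {h : E → ℂ} (h₁ : Integrable h) (h₂ : MemLp h 2) :
    eLpNorm (𝓕 h) 2 = eLpNorm h 2 := by
  rw [← eLpNorm_congr_ae (fourier_toLp_ae_eq h₁ h₂), ← eLpNorm_congr_ae h₂.coeFn_toLp,
    ← Lp.enorm_def, ← Lp.enorm_def, ← ofReal_norm, ← ofReal_norm, Lp.norm_fourier_eq]

theorem fourier_toLp_eq {h : E → ℂ} (h₁ : Integrable h) (h₂ : MemLp h 2) :
    (𝓕 (h₂.toLp h) : Lp ℂ 2 (volume : Measure E)) = (memLp_fourier h₁ h₂).toLp _ :=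
  Lp.ext ((fourier_toLp_ae_eq h₁ h₂).trans (MemLp.coeFn_toLp _).symm)

end Fourier

/-! ### Algebra of displacement operators -/

/-- The Weyl relation. The translations commute, and the phases differ by the symplectic form; its
factor 2 is the product of the √2 in `pos` and the √2 in `mom`. -/
theorem D_comm (u w : ℂ) (φ : H) :
    D w (D u φ) = Complex.exp (((2 * (u.re * w.im - u.im * w.re) : ℝ) : ℂ) * Complex.I) •
      D u (D w φ) := by
  have h2 : √2 * √2 = (2 : ℝ) := Real.mul_self_sqrt (by norm_num)
  have key : ∀ x, displaceFun w (displaceFun u φ) x =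
      Complex.exp (((2 * (u.re * w.im - u.im * w.re) : ℝ) : ℂ) * Complex.I) *
        displaceFun u (displaceFun w φ) x := by
    intro x
    simp only [displaceFun, ← mul_assoc, ← Complex.exp_add]
    rw [show x - pos w - pos u = x - pos u - pos w by ring]
    congr 2
    rw [← add_mul, ← add_mul, ← add_mul]
    congr 1
    norm_cast
    simp only [mom, pos]
    linear_combination (u.re * w.im - u.im * w.re) * h2
  refine Lp.ext ?_
  filter_upwards [D_coeFn w (D u φ), displaceFun_congr w (D_coeFn u φ), D_coeFn u (D w φ),
    displaceFun_congr u (D_coeFn w φ), Lp.coeFn_smul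
      (Complex.exp (((2 * (u.re * w.im - u.im * w.re) : ℝ) : ℂ) * Complex.I)) (D u (D w φ))]
    with x h₁ h₂ h₃ h₄ h₅
  rw [h₁, h₂, h₅, Pi.smul_apply, h₃, h₄, key, smul_eq_mul]

theorem D_neg_apply (z : ℂ) (φ : H) : D (-z) (D z φ) = φ := by
  refine Lp.ext ?_
  filter_upwards [D_coeFn (-z) (D z φ), displaceFun_congr (-z) (D_coeFn z φ)] with x h₁ h₂
  rw [h₁, h₂]
  simp only [displaceFun, ← mul_assoc, ← Complex.exp_add]
  have h₀ : pos (-z) = -pos z ∧ mom (-z) = -mom z := by simp [pos, mom]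
  rw [h₀.1, h₀.2, ← add_mul]
  convert one_mul (φ x) using 2
  · convert Complex.exp_zero using 2
    norm_cast
    ring_nf
    simp
  · ring_nf

theorem inner_D_D (z : ℂ) (φ ψ : H) : ⟪D z φ, D z ψ⟫_ℂ = ⟪φ, ψ⟫_ℂ :=
  (displacementIsometry z).inner_map_map φ ψ

theorem adjoint_D (z : ℂ) : ContinuousLinearMap.adjoint (D z) = D (-z) := by
  ext1 φ
  refine ext_inner_left ℂ fun ψ => ?_
  rw [ContinuousLinearMap.adjoint_inner_right]
  conv_lhs => rw [← D_neg_apply (-z) φ, neg_neg]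
  exact inner_D_D z _ _

theorem inner_D_conj (u w : ℂ) (φ ψ : H) :
    ⟪D u φ, D w (D u ψ)⟫_ℂ =
      Complex.exp (((2 * (u.re * w.im - u.im * w.re) : ℝ) : ℂ) * Complex.I) * ⟪φ, D w ψ⟫_ℂ := by
  rw [D_comm, inner_smul_right, inner_D_D]

theorem norm_D (z : ℂ) (φ : H) : ‖D z φ‖ = ‖φ‖ := (displacementIsometry z).norm_map φ

open FourierTransform

/-! ### The Moyal identity for the displacement operators. -/

theorem lintegral_comp_mul_right_real (f : ℝ → ℝ≥0∞) {c : ℝ} (hc : 0 < c) :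
    ∫⁻ x, f (x * c) = ENNReal.ofReal c⁻¹ * ∫⁻ x, f x := by
  have h := Real.map_volume_mul_right hc.ne'
  have e := lintegral_map_equiv (μ := volume) f (MeasurableEquiv.mulRight₀ c hc.ne')
  rw [MeasurableEquiv.coe_mulRight₀] at e
  rw [← e, h, lintegral_smul_measure, abs_of_pos (inv_pos.2 hc), smul_eq_mul]

theorem lintegral_phaseMeasure (f : ℂ → ℝ≥0∞) :
    ∫⁻ z, f z ∂phaseMeasure = ENNReal.ofReal Real.pi⁻¹ * ∫⁻ z, f z := by
  rw [phaseMeasure, lintegral_smul_measure, smul_eq_mul]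

theorem lintegral_complex {f : ℂ → ℝ≥0∞} (hf : Measurable f) :
    ∫⁻ z, f z = ∫⁻ a : ℝ, ∫⁻ b : ℝ, f ⟨a, b⟩ := by
  have h := Complex.volume_preserving_equiv_real_prod.symm.lintegral_comp hf
  rw [← h, Measure.volume_eq_prod, lintegral_prod _ (by fun_prop)]
  rfl

theorem ae_phaseMeasure_iff {p : ℂ → Prop} :
    (∀ᵐ z ∂phaseMeasure, p z) ↔ ∀ᵐ z, p z :=
  Measure.ae_ennreal_smul_measure_iff (by simp [Real.pi_pos])

theorem measurable_uncurry_displaceFun {φ : ℝ → ℂ} (hφ : Measurable φ) :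
    Measurable fun p : ℂ × ℝ => displaceFun p.1 φ p.2 := by
  unfold displaceFun mom pos
  fun_prop

theorem inner_D_left_eq (z : ℂ) (φ ψ : H) :
    ⟪D z ψ, φ⟫_ℂ = ∫ x, φ x * starRingEnd ℂ (displaceFun z ψ x) := by
  rw [L2.inner_def]
  refine integral_congr_ae ?_
  filter_upwards [D_coeFn z ψ] with x hx
  rw [hx, RCLike.inner_apply]

theorem measurable_inner_D_left (φ ψ : H) : Measurable fun z => ⟪D z ψ, φ⟫_ℂ := by
  simp_rw [inner_D_left_eq]
  have h₁ := measurable_uncurry_displaceFun (Lp.stronglyMeasurable ψ).measurable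
  have h₂ := (Lp.stronglyMeasurable φ).measurable
  have : Measurable fun p : ℂ × ℝ => φ p.2 * starRingEnd ℂ (displaceFun p.1 ψ p.2) := by
    fun_prop
  exact this.stronglyMeasurable.integral_prod_right.measurable

theorem inner_D_left_eq_fourier (z : ℂ) (φ ψ : H) :
    ⟪D z ψ, φ⟫_ℂ = Complex.exp (((mom z * pos z / 2 : ℝ) : ℂ) * Complex.I) *
      𝓕 (fun x : ℝ => φ x * starRingEnd ℂ (ψ (x - pos z))) (mom z / (2 * Real.pi)) := by
  rw [inner_D_left_eq, Real.fourier_real_eq_integral_exp_smul, ← integral_const_mul]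
  refine integral_congr_ae (Eventually.of_forall fun x => ?_)
  simp only [displaceFun, map_mul, ← Complex.exp_conj, Complex.conj_I, Complex.conj_ofReal,
    smul_eq_mul]
  have : Complex.exp (((mom z * (x - pos z / 2) : ℝ) : ℂ) * -Complex.I) =
      Complex.exp (((mom z * pos z / 2 : ℝ) : ℂ) * Complex.I) *
        Complex.exp (((-2 * Real.pi * x * (mom z / (2 * Real.pi)) : ℝ) : ℂ) * Complex.I) := by
    rw [← Complex.exp_add]
    congr 1
    have hπ := Complex.ofReal_ne_zero.2 Real.pi_ne_zero
    push_cast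
    field_simp
    ring
  rw [this]
  ring

theorem lintegral_enorm_sq {α : Type*} [MeasurableSpace α] (f : α → ℂ) (μ : Measure α) :
    ∫⁻ x, ‖f x‖ₑ ^ 2 ∂μ = eLpNorm f 2 μ ^ 2 := by
  have := eLpNorm_nnreal_pow_eq_lintegral (f := f) (μ := μ) (p := 2) (by norm_num)
  simpa using this.symm

theorem lintegral_enorm_sq_coeFn (φ : H) : ∫⁻ x, ‖φ x‖ₑ ^ 2 = ENNReal.ofReal (‖φ‖ ^ 2) := by
  rw [lintegral_enorm_sq, ← Lp.enorm_def, ← ofReal_norm, ENNReal.ofReal_pow (norm_nonneg _)]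

theorem integrable_mul_conj_translate (φ ψ : H) (q : ℝ) :
    Integrable fun x => φ x * starRingEnd ℂ (ψ (x - q)) := by
  have h : MemLp (fun x => ψ (x - q)) 2 :=
    (Lp.memLp ψ).comp_measurePreserving (measurePreserving_sub_right volume q)
  exact (Lp.memLp φ).integrable_mul h.star

/-- For fixed position the matrix element is, up to a phase, a Fourier transform in the momentum:
Plancherel there, then Tonelli and translation invariance in the position. -/
theorem moyal (φ ψ : H) :
    ∫⁻ z, ‖⟪D z ψ, φ⟫_ℂ‖ₑ ^ 2 ∂phaseMeasure = ENNReal.ofReal (‖φ‖ ^ 2 * ‖ψ‖ ^ 2) := by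
  have hφ := (Lp.stronglyMeasurable φ).measurable
  have hψ := (Lp.stronglyMeasurable ψ).measurable
  have hm := measurable_inner_D_left φ ψ
  set h : ℝ → ℝ → ℂ := fun q x => φ x * starRingEnd ℂ (ψ (x - q)) with hdef
  have hmeas : Measurable fun p : ℝ × ℝ => h (√2 * p.1) p.2 := by
    have h₁ : Measurable fun p : ℝ × ℝ => ψ (p.2 - √2 * p.1) := by fun_prop
    exact (hφ.comp measurable_snd).mul (Complex.continuous_conj.measurable.comp h₁)
  have henorm : ∀ a x, ‖h (√2 * a) x‖ₑ ^ 2 = ‖φ x‖ₑ ^ 2 * ‖ψ (x - a * √2)‖ₑ ^ 2 := by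
    intro a x
    rw [hdef, enorm_mul, mul_pow, RCLike.enorm_conj, mul_comm a]
  have htot : ∫⁻ a : ℝ, ∫⁻ x, ‖h (√2 * a) x‖ₑ ^ 2 =
      ENNReal.ofReal (√2)⁻¹ * ENNReal.ofReal (‖φ‖ ^ 2 * ‖ψ‖ ^ 2) := by
    rw [lintegral_lintegral_swap (by fun_prop)]
    have hx : ∀ x, ∫⁻ a : ℝ, ‖h (√2 * a) x‖ₑ ^ 2 =
        (ENNReal.ofReal (√2)⁻¹ * ENNReal.ofReal (‖ψ‖ ^ 2)) * ‖φ x‖ₑ ^ 2 := by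
      intro x
      simp_rw [henorm]
      rw [lintegral_const_mul _ (by fun_prop),
        lintegral_comp_mul_right_real (fun a => ‖ψ (x - a)‖ₑ ^ 2) (by positivity),
        lintegral_sub_left_eq_self (fun a => ‖ψ a‖ₑ ^ 2) x, lintegral_enorm_sq_coeFn, mul_comm]
    simp_rw [hx]
    rw [lintegral_const_mul _ (by fun_prop), lintegral_enorm_sq_coeFn, mul_assoc,
      mul_comm (‖φ‖ ^ 2), ENNReal.ofReal_mul (sq_nonneg _)]
  have hmeas' : Measurable fun a : ℝ => ∫⁻ x, ‖h (√2 * a) x‖ₑ ^ 2 :=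
    Measurable.lintegral_prod_right' (f := fun p : ℝ × ℝ => ‖h (√2 * p.1) p.2‖ₑ ^ 2)
      (hmeas.enorm.pow_const 2)
  -- A product of two L² functions is only integrable in general; finiteness of the double integral
  -- puts almost every slice in L².
  have hL2 : ∀ᵐ a : ℝ, MemLp (h (√2 * a)) 2 := by
    filter_upwards [ae_lt_top hmeas' (by rw [htot]; finiteness)] with a ha
    refine ⟨(hmeas.comp measurable_prodMk_left).aestronglyMeasurable, ?_⟩
    rw [lintegral_enorm_sq] at ha
    simpa using ha
  rw [lintegral_phaseMeasure, lintegral_complex (by fun_prop)]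
  have hinner : ∀ᵐ a : ℝ, ∫⁻ b : ℝ, ‖⟪D ⟨a, b⟩ ψ, φ⟫_ℂ‖ₑ ^ 2 =
      ENNReal.ofReal (√2 / (2 * Real.pi))⁻¹ * ∫⁻ x, ‖h (√2 * a) x‖ₑ ^ 2 := by
    filter_upwards [hL2] with a ha
    rw [lintegral_enorm_sq (h (√2 * a)),
      ← eLpNorm_fourier (integrable_mul_conj_translate φ ψ _) ha, ← lintegral_enorm_sq,
      ← lintegral_comp_mul_right_real _ (by positivity)]
    refine lintegral_congr fun b => ?_
    rw [inner_D_left_eq_fourier, enorm_mul, ← ofReal_norm (Complex.exp _),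
      Complex.norm_exp_ofReal_mul_I, ENNReal.ofReal_one, one_mul]
    have hb : mom ⟨a, b⟩ / (2 * Real.pi) = b * (√2 / (2 * Real.pi)) := by
      simp only [mom]
      ring
    rw [hb]
    rfl
  rw [lintegral_congr_ae hinner, lintegral_const_mul _ hmeas', htot, ← mul_assoc, ← mul_assoc,
    ← ENNReal.ofReal_mul (by positivity), ← ENNReal.ofReal_mul (by positivity)]
  convert one_mul (ENNReal.ofReal (‖φ‖ ^ 2 * ‖ψ‖ ^ 2))
  -- The constants cancel: `π⁻¹ * (2π / √2) * (1 / √2) = 1`.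
  rw [← ENNReal.ofReal_one]
  congr 1
  have h2 : √2 * √2 = (2 : ℝ) := Real.mul_self_sqrt (by norm_num)
  have := Real.pi_pos
  field_simp
  linarith

theorem memLp_inner_D (φ ψ : H) : MemLp (fun z => ⟪D z ψ, φ⟫_ℂ) 2 phaseMeasure := by
  refine ⟨(measurable_inner_D_left φ ψ).aestronglyMeasurable, ?_⟩
  have h := moyal φ ψ
  rw [lintegral_enorm_sq] at h
  exact (ENNReal.pow_lt_top_iff.1 (h ▸ ENNReal.ofReal_lt_top)).resolve_right two_ne_zero

theorem eLpNorm_inner_D (φ ψ : H) :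
    eLpNorm (fun z => ⟪D z ψ, φ⟫_ℂ) 2 phaseMeasure = ENNReal.ofReal (‖φ‖ * ‖ψ‖) := by
  have h := moyal φ ψ
  rw [lintegral_enorm_sq, ← mul_pow, ENNReal.ofReal_pow (by positivity)] at h
  exact (ENNReal.pow_right_strictMono two_ne_zero).injective h

/-! ### The symplectic Fourier transform -/

/-- The point at which the Fourier transform on `ℂ` is the symplectic Fourier transform at `z`. -/
def dualPoint : ℂ ≃ₜ ℂ :=
  Homeomorph.mulLeft₀ (Complex.I / Real.pi)
    (div_ne_zero Complex.I_ne_zero (Complex.ofReal_ne_zero.2 Real.pi_ne_zero))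

theorem dualPoint_apply (z : ℂ) : dualPoint z = Complex.I / Real.pi * z := rfl

theorem map_dualPoint : phaseMeasure.map dualPoint = ENNReal.ofReal Real.pi • volume := by
  have h₁ : MeasurePreserving (rotation (Circle.exp (Real.pi / 2)) : ℂ → ℂ) volume volume :=
    (rotation _).measurePreserving
  have h₂ := Measure.map_addHaar_smul (volume : Measure ℂ) (inv_ne_zero Real.pi_ne_zero)
  have h₃ : (dualPoint : ℂ → ℂ) =
      (fun z => Real.pi⁻¹ • z) ∘ (rotation (Circle.exp (Real.pi / 2)) : ℂ → ℂ) := by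
    funext z
    simp [dualPoint_apply, Complex.exp_pi_div_two_mul_I]
    ring
  rw [phaseMeasure, Measure.map_smul, h₃, ← Measure.map_map (by fun_prop) h₁.measurable, h₁.map_eq,
    h₂, smul_smul, ← ENNReal.ofReal_mul (by positivity), Complex.finrank_real_complex]
  congr 2
  have := Real.pi_pos
  rw [abs_of_pos (by positivity)]
  field_simp

theorem eLpNorm_comp_dualPoint (f : ℂ → ℂ) :
    eLpNorm (fun z => f (dualPoint z)) 2 phaseMeasure =
      ENNReal.ofReal (√Real.pi) * eLpNorm f 2 volume := by
  have h := dualPoint.measurableEmbedding.eLpNorm_map_measure (g := f) (p := 2) (μ := phaseMeasure)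
  rw [map_dualPoint, eLpNorm_smul_measure_of_ne_top (by norm_num)] at h
  refine h.symm.trans ?_
  rw [smul_eq_mul, ENNReal.ofReal_rpow_of_pos Real.pi_pos, Real.sqrt_eq_rpow]
  simp

theorem eLpNorm_phaseMeasure (f : ℂ → ℂ) :
    eLpNorm f 2 phaseMeasure = ENNReal.ofReal (√Real.pi)⁻¹ * eLpNorm f 2 volume := by
  rw [phaseMeasure, eLpNorm_smul_measure_of_ne_top (by norm_num), smul_eq_mul,
    ENNReal.ofReal_rpow_of_pos (by positivity), ← Real.sqrt_inv, Real.sqrt_eq_rpow]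
  simp

theorem continuous_fourier {h : ℂ → ℂ} (hh : Integrable h) : Continuous (𝓕 h) :=
  VectorFourier.fourierIntegral_continuous Real.continuous_fourierChar
    (by exact continuous_inner) hh

theorem integrable_phaseMeasure_iff {E : Type*} [NormedAddCommGroup E] {f : ℂ → E} :
    Integrable f phaseMeasure ↔ Integrable f := by
  rw [phaseMeasure, integrable_smul_measure (by simp [Real.pi_pos]) (by simp)]

theorem memLp_phaseMeasure_iff {f : ℂ → ℂ} {p : ℝ≥0∞} :
    MemLp f p phaseMeasure ↔ MemLp f p := by
  refine ⟨fun h => ?_, fun h => h.smul_measure ENNReal.ofReal_ne_top⟩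
  have hv : (volume : Measure ℂ) = ENNReal.ofReal Real.pi • phaseMeasure := by
    rw [phaseMeasure, smul_smul, ← ENNReal.ofReal_mul Real.pi_pos.le,
      mul_inv_cancel₀ Real.pi_ne_zero, ENNReal.ofReal_one, one_smul]
  rw [hv]
  exact h.smul_measure ENNReal.ofReal_ne_top

theorem integral_phaseMeasure (f : ℂ → ℂ) :
    ∫ z, f z ∂phaseMeasure = (Real.pi : ℂ)⁻¹ * ∫ z, f z := by
  rw [phaseMeasure, integral_smul_measure, ENNReal.toReal_ofReal (by positivity)]
  simp

/-- The exponent is `-2πi` times the real inner product of `w` with `i z / π`, which is what fixes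
`dualPoint`. -/
theorem integral_phase_mul (z : ℂ) (h : ℂ → ℂ) :
    ∫ w, Complex.exp (((2 * ((-z).re * w.im - (-z).im * w.re) : ℝ) : ℂ) * Complex.I) * h w
      ∂phaseMeasure = (Real.pi : ℂ)⁻¹ * 𝓕 h (dualPoint z) := by
  rw [integral_phaseMeasure, Real.fourier_eq']
  congr 1
  refine integral_congr_ae (Eventually.of_forall fun w => ?_)
  simp only [smul_eq_mul]
  congr 4
  rw [dualPoint_apply, Complex.inner]
  have := Real.pi_pos
  simp
  field_simp
  ring

theorem integral_mul_inner_D_conj (g : ℂ → ℂ) (φ ψ : H) (z : ℂ) :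
    ∫ w, g w * ⟪D (-z) φ, D w (D (-z) ψ)⟫_ℂ ∂phaseMeasure =
      (Real.pi : ℂ)⁻¹ * 𝓕 (fun w => g w * ⟪φ, D w ψ⟫_ℂ) (dualPoint z) := by
  rw [← integral_phase_mul]
  refine integral_congr_ae (Eventually.of_forall fun w => ?_)
  simp only [inner_D_conj]
  ring

/-! ### Totality of the matrix elements of the displacement operators -/

theorem exists_mem_ne_zero_of_dense {V : Submodule ℂ H} (hd : Dense (V : Set H)) :
    ∃ ψ ∈ V, ψ ≠ 0 := by
  by_contra! h
  have hV : (V : Set H) ⊆ {0} := fun ψ hψ => h ψ hψ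
  obtain ⟨b⟩ := exists_hilbertBasis_nat
  have : b 0 ∈ closure ({0} : Set H) := closure_mono hV (hd (b 0))
  rw [closure_singleton, Set.mem_singleton_iff] at this
  exact b.orthonormal.ne_zero 0 this

/-- Invariance of `V` allows both vectors to be displaced, which turns one vanishing integral into a
vanishing Fourier transform. Hence `g z * ⟪φ, D z ψ⟫` vanishes almost everywhere for each pair. With
`ψ ≠ 0` fixed and `φ` in a countable dense set, one null set serves all `φ`, and outside it `g z ≠
0` would give `D z ψ = 0`. -/
theorem ae_eq_zero_of_integral_mul_inner_D {V : Submodule ℂ H} (hd : Dense (V : Set H))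
    (hV : ∀ z, ∀ φ ∈ V, D z φ ∈ V) {g : ℂ → ℂ}
    (hg : ∀ φ ∈ V, ∀ ψ ∈ V, Integrable (fun z => g z * ⟪φ, D z ψ⟫_ℂ) phaseMeasure)
    (h0 : ∀ φ ∈ V, ∀ ψ ∈ V, ∫ z, g z * ⟪φ, D z ψ⟫_ℂ ∂phaseMeasure = 0) : ∀ᵐ z, g z = 0 := by
  have hzero : ∀ φ ∈ V, ∀ ψ ∈ V, ∀ᵐ z, g z * ⟪φ, D z ψ⟫_ℂ = 0 := by
    intro φ hφ ψ hψ
    refine ae_eq_zero_of_fourier_eq_zero (integrable_phaseMeasure_iff.1 (hg φ hφ ψ hψ)) fun ξ => ?_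
    obtain ⟨z, rfl⟩ := dualPoint.surjective ξ
    have h := h0 _ (hV (-z) φ hφ) _ (hV (-z) ψ hψ)
    rw [integral_mul_inner_D_conj] at h
    exact (mul_eq_zero.1 h).resolve_left
      (inv_ne_zero (Complex.ofReal_ne_zero.2 Real.pi_ne_zero))
  obtain ⟨ψ, hψ, hψ0⟩ := exists_mem_ne_zero_of_dense hd
  have : Fact ((2 : ℝ≥0∞) ≠ ∞) := ⟨by norm_num⟩
  obtain ⟨s, hs, hsd⟩ := TopologicalSpace.exists_countable_dense V
  have hrange : DenseRange fun φ : s => ((φ : V) : H) :=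
    hd.denseRange_val.comp hsd.denseRange_val continuous_subtype_val
  have := hs.to_subtype
  filter_upwards [ae_all_iff.2 fun φ : s => hzero (φ : V) (φ : V).2 ψ hψ] with z hz
  by_contra hgz
  have h : ∀ φ : H, ⟪φ, D z ψ⟫_ℂ = 0 := fun φ =>
    hrange.induction_on φ (isClosed_eq (by fun_prop) continuous_const)
      fun φ => (mul_eq_zero.1 (hz φ)).resolve_left hgz
  have h' := inner_self_eq_zero.1 (h (D z ψ))
  rw [← norm_eq_zero, norm_D, norm_eq_zero] at h'
  exact hψ0 h'

theorem integrable_mul_inner_D {g : ℂ → ℂ} (hg : MemLp g 2 phaseMeasure) (φ ψ : H) :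
    Integrable (fun z => g z * ⟪φ, D z ψ⟫_ℂ) phaseMeasure := by
  refine (hg.integrable_mul (memLp_inner_D φ ψ).star).congr (Eventually.of_forall fun z => ?_)
  simp [inner_conj_symm]

theorem isMoyalFrame_D : IsMoyalFrame D where
  memLp := memLp_inner_D
  eLpNorm_eq := eLpNorm_inner_D
  eq_zero f hf h := ae_phaseMeasure_iff.2 <|
    ae_eq_zero_of_integral_mul_inner_D (V := ⊤) (by simp) (by simp)
      (fun φ _ ψ _ => integrable_mul_inner_D hf φ ψ) fun φ _ ψ _ => h φ ψ

/-! ### Matrix elements of the displaced operators -/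

/-- The isometry property of a family of functions extends from a dense subspace. -/
theorem memLp_of_dense {V : Submodule ℂ H} (hd : Dense (V : Set H)) (L : H → ℂ → ℂ)
    (hadd : ∀ φ φ', L (φ + φ') = L φ + L φ') (hcont : ∀ z, Continuous fun φ => L φ z) (c : ℝ)
    (hV : ∀ φ ∈ V, MemLp (L φ) 2 phaseMeasure ∧
      eLpNorm (L φ) 2 phaseMeasure = ENNReal.ofReal (‖φ‖ * c)) (φ : H) :
    MemLp (L φ) 2 phaseMeasure ∧ eLpNorm (L φ) 2 phaseMeasure = ENNReal.ofReal (‖φ‖ * c) := by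
  -- The upper bound for all `φ` is Fatou's lemma along a sequence from `V`.
  have hle : ∀ φ, AEStronglyMeasurable (L φ) phaseMeasure ∧
      eLpNorm (L φ) 2 phaseMeasure ≤ ENNReal.ofReal (‖φ‖ * c) := by
    intro φ
    obtain ⟨u, huV, hu⟩ := mem_closure_iff_seq_limit.1 (hd φ)
    have hlim : ∀ z, Tendsto (fun n => L (u n) z) atTop (𝓝 (L φ z)) := fun z =>
      ((hcont z).tendsto φ).comp hu
    refine ⟨aestronglyMeasurable_of_tendsto_ae atTop (fun n => (hV _ (huV n)).1.1)
      (Eventually.of_forall hlim), ?_⟩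
    refine (Lp.eLpNorm_lim_le_liminf_eLpNorm (fun n => (hV _ (huV n)).1.1) _
      (Eventually.of_forall hlim)).trans (le_of_eq ?_)
    simp_rw [fun n => (hV _ (huV n)).2]
    exact (ENNReal.tendsto_ofReal (hu.norm.mul_const c)).liminf_eq
  refine ⟨⟨(hle φ).1, (hle φ).2.trans_lt ENNReal.ofReal_lt_top⟩, (hle φ).2.antisymm ?_⟩
  obtain ⟨u, huV, hu⟩ := mem_closure_iff_seq_limit.1 (hd φ)
  -- The lower bound is the triangle inequality, with the upper bound applied to `u n - φ`.
  have h₁ : ∀ n, ENNReal.ofReal (‖u n‖ * c) ≤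
      eLpNorm (L φ) 2 phaseMeasure + ENNReal.ofReal (‖u n - φ‖ * c) := by
    intro n
    rw [← (hV _ (huV n)).2]
    conv_lhs => rw [← add_sub_cancel φ (u n), hadd]
    exact (eLpNorm_add_le (hle φ).1 (hle _).1 (by norm_num)).trans
      (add_le_add_right (hle _).2 _)
  have h₂ : Tendsto (fun n => eLpNorm (L φ) 2 phaseMeasure + ENNReal.ofReal (‖u n - φ‖ * c)) atTop
      (𝓝 (eLpNorm (L φ) 2 phaseMeasure + 0)) := by
    refine Tendsto.add tendsto_const_nhds ?_
    have := ENNReal.tendsto_ofReal ((tendsto_iff_norm_sub_tendsto_zero.1 hu).mul_const c)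
    simpa using this
  simpa using le_of_tendsto_of_tendsto' (ENNReal.tendsto_ofReal (hu.norm.mul_const c)) h₂ h₁

theorem integral_comp_dualPoint (f : ℂ → ℂ) :
    ∫ z, f (dualPoint z) ∂phaseMeasure = Real.pi * ∫ z, f z := by
  rw [← dualPoint.measurableEmbedding.integral_map, map_dualPoint, integral_smul_measure,
    ENNReal.toReal_ofReal Real.pi_pos.le]
  simp

theorem memLp_comp_dualPoint_symm {f : ℂ → ℂ} (hf : MemLp f 2 phaseMeasure) :
    MemLp (fun ξ => f (dualPoint.symm ξ)) 2 := by
  have h := (dualPoint.measurableEmbedding.memLp_map_measure_iff (μ := phaseMeasure) (p := 2)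
    (g := fun ξ => f (dualPoint.symm ξ))).2 (by simpa [Function.comp_def] using hf)
  have hv : (volume : Measure ℂ) = ENNReal.ofReal Real.pi⁻¹ • phaseMeasure.map dualPoint := by
    rw [map_dualPoint, smul_smul, ← ENNReal.ofReal_mul (by positivity),
      inv_mul_cancel₀ Real.pi_ne_zero, ENNReal.ofReal_one, one_smul]
  rw [hv]
  exact h.smul_measure ENNReal.ofReal_ne_top

/-- The transpose of the symplectic Fourier transform on `L²`. -/
theorem exists_fourier_dual {f : ℂ → ℂ} (hf : MemLp f 2 phaseMeasure) :
    ∃ k : ℂ → ℂ, MemLp k 2 phaseMeasure ∧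
      (∀ h : ℂ → ℂ, Integrable h → MemLp h 2 →
        ∫ z, f z * 𝓕 h (dualPoint z) ∂phaseMeasure = ∫ z, k z * h z ∂phaseMeasure) ∧
      (k =ᵐ[phaseMeasure] 0 → f =ᵐ[phaseMeasure] 0) := by
  have hF : MemLp (fun ξ => starRingEnd ℂ (f (dualPoint.symm ξ))) 2 :=
    (memLp_comp_dualPoint_symm hf).star
  set F : Lp ℂ 2 (volume : Measure ℂ) := hF.toLp _
  have hFF : 𝓕 (𝓕⁻ F : Lp ℂ 2 (volume : Measure ℂ)) = F := fourier_fourierInv_eq F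
  have hFae : F =ᵐ[volume] fun ξ => starRingEnd ℂ (f (dualPoint.symm ξ)) := hF.coeFn_toLp
  set K : Lp ℂ 2 (volume : Measure ℂ) := 𝓕⁻ F
  have hK : MemLp (fun z => starRingEnd ℂ (K z)) 2 phaseMeasure :=
    memLp_phaseMeasure_iff.2 (Lp.memLp K).star
  -- The conjugations turn the sesquilinear L² product into the bilinear pairing. One factor π comes
  -- from the change of variables by `dualPoint`, the other from returning to `phaseMeasure`.
  refine ⟨fun z => Real.pi ^ 2 * starRingEnd ℂ (K z), hK.const_mul _, fun h h₁ h₂ => ?_,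
    fun hk => ?_⟩
  · have e := Lp.inner_fourier_eq K (h₂.toLp h)
    rw [hFF, fourier_toLp_eq h₁ h₂, L2.inner_def, L2.inner_def] at e
    have e₁ := integral_comp_dualPoint fun ξ => f (dualPoint.symm ξ) * 𝓕 h ξ
    simp only [Homeomorph.symm_apply_apply] at e₁
    rw [e₁]
    have e₂ : ∫ ξ, f (dualPoint.symm ξ) * 𝓕 h ξ = ∫ ξ, starRingEnd ℂ (K ξ) * h ξ := by
      refine Eq.trans ?_ (e.trans ?_)
      · refine integral_congr_ae ?_
        filter_upwards [hFae, (memLp_fourier h₁ h₂).coeFn_toLp] with ξ hξ hξ'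
        rw [hξ, hξ', RCLike.inner_apply, Complex.conj_conj, mul_comm]
      · refine integral_congr_ae ?_
        filter_upwards [h₂.coeFn_toLp] with ξ hξ
        rw [hξ, RCLike.inner_apply, mul_comm]
    rw [e₂, integral_phaseMeasure]
    simp_rw [mul_assoc]
    rw [integral_const_mul]
    have := Complex.ofReal_ne_zero.2 Real.pi_ne_zero
    field_simp
  · have hK0 : K = 0 := by
      rw [Lp.eq_zero_iff_ae_eq_zero]
      filter_upwards [ae_phaseMeasure_iff.1 hk] with z hz
      simpa [Real.pi_ne_zero] using hz
    have hF0 : F =ᵐ[volume] 0 := by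
      rw [← Lp.eq_zero_iff_ae_eq_zero, ← hFF, hK0]
      exact FourierTransform.fourier_zero
    have h : ∀ᵐ ξ ∂(phaseMeasure.map dualPoint), f (dualPoint.symm ξ) = 0 := by
      rw [map_dualPoint]
      refine Measure.ae_smul_measure ?_ _
      filter_upwards [hF0, hFae] with ξ h₁ h₂
      rw [h₂] at h₁
      simpa using h₁
    have h' := ae_of_ae_map dualPoint.continuous.aemeasurable h
    simp only [Homeomorph.symm_apply_apply] at h'
    exact h'

section

variable {ϖ : ℂ → ℂ} {M : H →L[ℂ] H} {V : Submodule ℂ H}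

theorem inner_displaced_eq_fourier (hV : ∀ z, ∀ φ ∈ V, D z φ ∈ V)
    (hM : ∀ φ ∈ V, ∀ ψ ∈ V, ⟪φ, M ψ⟫_ℂ = ∫ z, ϖ z * ⟪φ, D z ψ⟫_ℂ ∂phaseMeasure)
    {φ ψ : H} (hφ : φ ∈ V) (hψ : ψ ∈ V) (z : ℂ) :
    ⟪φ, displaced M z ψ⟫_ℂ =
      (Real.pi : ℂ)⁻¹ * 𝓕 (fun w => ϖ w * ⟪φ, D w ψ⟫_ℂ) (dualPoint z) := by
  rw [displaced, ContinuousLinearMap.comp_apply, ContinuousLinearMap.comp_apply,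
    ← ContinuousLinearMap.adjoint_inner_left, adjoint_D, hM _ (hV _ _ hφ) _ (hV _ _ hψ),
    integral_mul_inner_D_conj]

theorem isMoyalFrame_displaced (hw : IsWeightIntegral ϖ M) (hϖ : ∀ᵐ z, ‖ϖ z‖ = 1) :
    IsMoyalFrame (displaced M) := by
  obtain ⟨V, hd, hV, hM⟩ := hw
  have hR := fun {φ ψ : H} (hφ : φ ∈ V) (hψ : ψ ∈ V) (z : ℂ) =>
    inner_displaced_eq_fourier hV (fun φ hφ ψ hψ => (hM φ hφ ψ hψ).2) hφ hψ z
  have h₁ : ∀ {φ ψ : H}, φ ∈ V → ψ ∈ V → Integrable fun w => ϖ w * ⟪φ, D w ψ⟫_ℂ :=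
    fun hφ hψ => integrable_phaseMeasure_iff.1 (hM _ hφ _ hψ).1
  have hnorm : ∀ φ ψ : H, ∀ᵐ w, ‖ϖ w * ⟪φ, D w ψ⟫_ℂ‖ = ‖⟪D w ψ, φ⟫_ℂ‖ := by
    intro φ ψ
    filter_upwards [hϖ] with w hw
    rw [norm_mul, hw, one_mul, norm_inner_symm]
  -- Measurability of the product is read off from its integrability; `ϖ` itself is not assumed
  -- measurable.
  have h₂ : ∀ {φ ψ : H}, φ ∈ V → ψ ∈ V → MemLp (fun w => ϖ w * ⟪φ, D w ψ⟫_ℂ) 2 :=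
    fun {φ ψ} hφ hψ => (memLp_phaseMeasure_iff.1 (memLp_inner_D φ ψ)).congr_norm
      (h₁ hφ hψ).1 ((hnorm φ ψ).mono fun w hw => hw.symm)
  have hsymm : ∀ φ ψ : H, ∀ z, ‖⟪displaced M z ψ, φ⟫_ℂ‖ = ‖⟪φ, displaced M z ψ⟫_ℂ‖ :=
    fun φ ψ z => norm_inner_symm _ _
  have hbase : ∀ φ ∈ V, ∀ ψ ∈ V, MemLp (fun z => ⟪displaced M z ψ, φ⟫_ℂ) 2 phaseMeasure ∧
      eLpNorm (fun z => ⟪displaced M z ψ, φ⟫_ℂ) 2 phaseMeasure =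
        ENNReal.ofReal (‖φ‖ * ‖ψ‖) := by
    intro φ hφ ψ hψ
    have hF := memLp_fourier (h₁ hφ hψ) (h₂ hφ hψ)
    have hconst : ∀ z, ⟪φ, displaced M z ψ⟫_ℂ = ((Real.pi : ℂ)⁻¹ •
        fun z => 𝓕 (fun w => ϖ w * ⟪φ, D w ψ⟫_ℂ) (dualPoint z)) z := fun z => hR hφ hψ z
    have hn : eLpNorm (fun z => ⟪displaced M z ψ, φ⟫_ℂ) 2 phaseMeasure =
        ENNReal.ofReal (‖φ‖ * ‖ψ‖) := by
      rw [eLpNorm_congr_norm_ae (Eventually.of_forall (hsymm φ ψ)), funext hconst,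
        eLpNorm_const_smul, eLpNorm_comp_dualPoint, eLpNorm_fourier (h₁ hφ hψ) (h₂ hφ hψ),
        ← eLpNorm_inner_D φ ψ, eLpNorm_phaseMeasure,
        ← eLpNorm_congr_norm_ae (hnorm φ ψ), ← mul_assoc]
      congr 1
      rw [← ofReal_norm, ← ENNReal.ofReal_mul (norm_nonneg _), norm_inv, Complex.norm_real,
        Real.norm_of_nonneg Real.pi_pos.le]
      congr 1
      have := Real.sqrt_pos.2 Real.pi_pos
      have h := Real.mul_self_sqrt Real.pi_pos.le
      field_simp
      linarith
    refine ⟨⟨?_, hn.trans_lt ENNReal.ofReal_lt_top⟩, hn⟩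
    have hc : Continuous fun z => ⟪φ, displaced M z ψ⟫_ℂ := by
      rw [funext fun z => hR hφ hψ z]
      exact continuous_const.mul ((continuous_fourier (h₁ hφ hψ)).comp dualPoint.continuous)
    simp_rw [← inner_conj_symm _ φ]
    exact (Complex.continuous_conj.comp hc).aestronglyMeasurable
  -- Density extends the relations from `V` one vector at a time, first in `φ`, then in `ψ`.
  have hall : ∀ φ ψ, MemLp (fun z => ⟪displaced M z ψ, φ⟫_ℂ) 2 phaseMeasure ∧
      eLpNorm (fun z => ⟪displaced M z ψ, φ⟫_ℂ) 2 phaseMeasure =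
        ENNReal.ofReal (‖φ‖ * ‖ψ‖) := by
    intro φ
    have hleft : ∀ ψ ∈ V, MemLp (fun z => ⟪displaced M z ψ, φ⟫_ℂ) 2 phaseMeasure ∧
        eLpNorm (fun z => ⟪displaced M z ψ, φ⟫_ℂ) 2 phaseMeasure =
          ENNReal.ofReal (‖ψ‖ * ‖φ‖) := fun ψ hψ => by
      rw [mul_comm]
      exact memLp_of_dense hd (fun φ z => ⟪displaced M z ψ, φ⟫_ℂ)
        (fun φ φ' => funext fun z => inner_add_right _ _ _) (fun z => by fun_prop) ‖ψ‖
        (fun φ hφ => hbase φ hφ ψ hψ) φ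
    intro ψ
    rw [mul_comm]
    exact memLp_of_dense hd (fun ψ z => ⟪displaced M z ψ, φ⟫_ℂ)
      (fun ψ ψ' => funext fun z => by simp [inner_add_left]) (fun z => by fun_prop) ‖φ‖ hleft ψ
  refine ⟨fun φ ψ => (hall φ ψ).1, fun φ ψ => (hall φ ψ).2, fun f hf h0 => ?_⟩
  -- Totality: moving the Fourier transform onto `f` makes `k * ϖ` annihilate the matrix elements of
  -- `D` on `V`, so `k = 0` almost everywhere as `ϖ ≠ 0` there.
  obtain ⟨k, hk, hkf, hk0⟩ := exists_fourier_dual hf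
  have hϖk : ∀ φ ∈ V, ∀ ψ ∈ V,
      Integrable (fun z => (k z * ϖ z) * ⟪φ, D z ψ⟫_ℂ) phaseMeasure := by
    intro φ hφ ψ hψ
    simp_rw [mul_assoc]
    exact hk.integrable_mul (memLp_phaseMeasure_iff.2 (h₂ hφ hψ))
  refine hk0 (ae_phaseMeasure_iff.2 ?_)
  have hzero := ae_eq_zero_of_integral_mul_inner_D hd hV hϖk fun φ hφ ψ hψ => by
    have h := hkf _ (h₁ hφ hψ) (h₂ hφ hψ)
    simp_rw [mul_assoc]
    rw [← h, ← mul_zero (Real.pi : ℂ), ← h0 φ ψ, ← integral_const_mul]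
    refine integral_congr_ae (Eventually.of_forall fun z => ?_)
    simp only [hR hφ hψ]
    have := Complex.ofReal_ne_zero.2 Real.pi_ne_zero
    field_simp
  filter_upwards [hzero, hϖ] with z hz hϖz
  have hne : ϖ z ≠ 0 := fun h => by simp [h] at hϖz
  exact (mul_eq_zero.1 hz).resolve_right hne

end

/-! ### Necessity of `‖ϖ‖ = 1`, and regular weights. -/

open SchwartzMap

theorem integral_norm_sq_eq {f : ℂ → ℂ} (hf : MemLp f 2 phaseMeasure) :
    ∫ z, ‖f z‖ ^ 2 ∂phaseMeasure = (eLpNorm f 2 phaseMeasure).toReal ^ 2 := by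
  rw [← ENNReal.toReal_pow, ← lintegral_enorm_sq, integral_eq_lintegral_of_nonneg_ae
    (Eventually.of_forall fun z => sq_nonneg _) (hf.1.norm.pow 2)]
  congr 1
  refine lintegral_congr fun z => ?_
  rw [ENNReal.ofReal_pow (norm_nonneg _), ofReal_norm]

/-- The function with symplectic Fourier transform `k`. -/
def symplecticFourierInv (k : 𝓢(ℂ, ℂ)) (z : ℂ) : ℂ := (Real.pi : ℂ)⁻¹ * 𝓕⁻ k (dualPoint z)

theorem eLpNorm_symplecticFourierInv (k : 𝓢(ℂ, ℂ)) :
    eLpNorm (symplecticFourierInv k) 2 phaseMeasure = eLpNorm k 2 phaseMeasure := by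
  have h := eLpNorm_fourier ((𝓕⁻ k).integrable (μ := volume)) ((𝓕⁻ k).memLp 2 volume)
  rw [← SchwartzMap.fourier_coe, fourier_fourierInv_eq] at h
  have hs : symplecticFourierInv k = (Real.pi : ℂ)⁻¹ • fun z => 𝓕⁻ k (dualPoint z) := rfl
  rw [hs, eLpNorm_const_smul, eLpNorm_comp_dualPoint, ← h, eLpNorm_phaseMeasure, ← mul_assoc]
  congr 1
  rw [← ofReal_norm, ← ENNReal.ofReal_mul (norm_nonneg _), norm_inv, Complex.norm_real,
    Real.norm_of_nonneg Real.pi_pos.le]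
  congr 1
  have := Real.sqrt_pos.2 Real.pi_pos
  have h := Real.mul_self_sqrt Real.pi_pos.le
  field_simp
  linarith

theorem symplecticFourierInv_mem (k : 𝓢(ℂ, ℂ)) :
    symplecticFourierInv k ∈ integrableSquareIntegrable := by
  have hs : symplecticFourierInv k = (Real.pi : ℂ)⁻¹ • fun z => 𝓕⁻ k (dualPoint z) := rfl
  have hp : ∀ p : ℝ≥0∞, MemLp (symplecticFourierInv k) p phaseMeasure := fun p => by
    rw [hs]
    refine MemLp.const_smul (f := fun z => 𝓕⁻ k (dualPoint z)) ?_ (Real.pi : ℂ)⁻¹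
    refine (dualPoint.measurableEmbedding.memLp_map_measure_iff (g := (𝓕⁻ k : 𝓢(ℂ, ℂ)))).1 ?_
    rw [map_dualPoint]
    exact ((𝓕⁻ k).memLp p volume).smul_measure ENNReal.ofReal_ne_top
  exact ⟨hp 1, hp 2⟩

section

variable {ϖ : ℂ → ℂ} {M : H →L[ℂ] H}

theorem integral_symplecticFourierInv_mul (k : 𝓢(ℂ, ℂ)) {h : ℂ → ℂ} (hh : Integrable h) :
    ∫ z, symplecticFourierInv k z * ((Real.pi : ℂ)⁻¹ * 𝓕 h (dualPoint z)) ∂phaseMeasure =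
      ∫ z, k z * h z ∂phaseMeasure := by
  have e₁ := integral_comp_dualPoint fun ξ => 𝓕⁻ k ξ * 𝓕 h ξ
  have e₂ := integral_smul_fourier_eq (𝓕⁻ k) hh
  rw [fourier_fourierInv_eq] at e₂
  simp only [smul_eq_mul] at e₂
  rw [e₂] at e₁
  have e₃ : ∀ z, symplecticFourierInv k z * ((Real.pi : ℂ)⁻¹ * 𝓕 h (dualPoint z)) =
      (Real.pi : ℂ)⁻¹ ^ 2 * (𝓕⁻ k (dualPoint z) * 𝓕 h (dualPoint z)) := fun z => by
    rw [symplecticFourierInv]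
    ring
  simp_rw [e₃]
  rw [integral_const_mul, e₁, integral_phaseMeasure]
  have := Complex.ofReal_ne_zero.2 Real.pi_ne_zero
  field_simp

/-- Multiplication by the weight function is isometric on Schwartz functions, if the quantization
is isometric. -/
theorem memLp_mul_weight (hw : IsWeightIntegral ϖ M)
    (h : IsometricOn M integrableSquareIntegrable) (k : 𝓢(ℂ, ℂ)) :
    MemLp (fun z => k z * ϖ z) 2 phaseMeasure ∧
      ∫ z, ‖k z * ϖ z‖ ^ 2 ∂phaseMeasure = ∫ z, ‖k z‖ ^ 2 ∂phaseMeasure := by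
  obtain ⟨V, hd, hV, hM⟩ := hw
  obtain ⟨b⟩ := exists_hilbertBasis_nat
  have hf := symplecticFourierInv_mem k
  obtain ⟨A, hA, htr⟩ := h _ hf
  -- The finite trace gives `A` a symbol `G` for the frame `D`, with the L² norm of `k`.
  obtain ⟨G, rfl⟩ := isMoyalFrame_D.exists_op_eq b A
    ((isMoyalFrame_D.isHilbertSchmidt_iff_summable b A).1 ⟨_, htr⟩)
  have hk2 : MemLp k 2 phaseMeasure := memLp_phaseMeasure_iff.2 (k.memLp 2 volume)
  have hG := (isMoyalFrame_D.hasTrace_adjoint_comp_op G G b).unique (htr b)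
  rw [inner_self_eq_norm_sq_to_K, integral_norm_sq_eq hf.2, eLpNorm_symplecticFourierInv,
    ← integral_norm_sq_eq hk2, Lp.norm_def] at hG
  have hG' : (eLpNorm G 2 phaseMeasure).toReal ^ 2 = ∫ z, ‖k z‖ ^ 2 ∂phaseMeasure := by
    have := congrArg Complex.re hG
    simpa [← Complex.ofReal_pow] using this
  have hint : ∀ φ ∈ V, ∀ ψ ∈ V, Integrable (fun z => k z * (ϖ z * ⟪φ, D z ψ⟫_ℂ)) phaseMeasure := by
    intro φ hφ ψ hψ
    exact (hM φ hφ ψ hψ).1.bdd_mul k.continuous.aestronglyMeasurable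
      (Eventually.of_forall k.toBoundedContinuousFunction.norm_coe_le_norm)
  have hsub : ∀ (φ ψ : H) (z : ℂ), (G z - k z * ϖ z) * ⟪φ, D z ψ⟫_ℂ =
      G z * ⟪φ, D z ψ⟫_ℂ - k z * (ϖ z * ⟪φ, D z ψ⟫_ℂ) := fun φ ψ z => by ring
  -- `G` and `k * ϖ` pair equally with the matrix elements on `V`. This works before `k * ϖ` is
  -- known to be in L².
  have hz := ae_eq_zero_of_integral_mul_inner_D hd hV (g := fun z => G z - k z * ϖ z)
    (fun φ hφ ψ hψ => by
      simp_rw [hsub]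
      exact (integrable_mul_inner_D (Lp.memLp G) φ ψ).sub (hint φ hφ ψ hψ))
    (fun φ hφ ψ hψ => by
      simp_rw [hsub]
      rw [integral_sub (integrable_mul_inner_D (Lp.memLp G) φ ψ) (hint φ hφ ψ hψ),
        ← isMoyalFrame_D.inner_coeff_eq_integral, ← isMoyalFrame_D.inner_op, (hA φ ψ).2,
        sub_eq_zero,
        ← integral_symplecticFourierInv_mul k (integrable_phaseMeasure_iff.1 (hM φ hφ ψ hψ).1)]
      refine integral_congr_ae (Eventually.of_forall fun z => ?_)
      simp only
      rw [inner_displaced_eq_fourier hV (fun φ hφ ψ hψ => (hM φ hφ ψ hψ).2) hφ hψ z])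
  have hae : G =ᵐ[phaseMeasure] fun z => k z * ϖ z :=
    ae_phaseMeasure_iff.2 (hz.mono fun z hz => sub_eq_zero.1 hz)
  have hL : MemLp (fun z => k z * ϖ z) 2 phaseMeasure := (memLp_congr_ae hae).1 (Lp.memLp G)
  refine ⟨hL, ?_⟩
  rw [integral_norm_sq_eq hL, ← eLpNorm_congr_ae hae, hG']

theorem integral_sq_mul_weight (hw : IsWeightIntegral ϖ M)
    (h : IsometricOn M integrableSquareIntegrable) {u : ℂ → ℝ}
    (hu : ContDiff ℝ ((⊤ : ℕ∞) : WithTop ℕ∞) u) (huc : HasCompactSupport u) :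
    Integrable (fun z => u z ^ 2 * (‖ϖ z‖ ^ 2 - 1)) ∧
      ∫ z, u z ^ 2 * (‖ϖ z‖ ^ 2 - 1) = 0 := by
  have hu₁ : HasCompactSupport (Complex.ofRealCLM ∘ u) := huc.comp_left rfl
  have hu₂ : ContDiff ℝ ((⊤ : ℕ∞) : WithTop ℕ∞) (Complex.ofRealCLM ∘ u) :=
    Complex.ofRealCLM.contDiff.comp hu
  obtain ⟨h₁, h₂⟩ := memLp_mul_weight hw h (hu₁.toSchwartzMap hu₂)
  have hk2 : MemLp (hu₁.toSchwartzMap hu₂) 2 phaseMeasure :=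
    memLp_phaseMeasure_iff.2 (SchwartzMap.memLp _ 2 volume)
  have i₁ := h₁.norm.integrable_sq
  have i₂ := hk2.norm.integrable_sq
  have e : ∀ z, ‖hu₁.toSchwartzMap hu₂ z * ϖ z‖ ^ 2 - ‖hu₁.toSchwartzMap hu₂ z‖ ^ 2 =
      u z ^ 2 * (‖ϖ z‖ ^ 2 - 1) := fun z => by
    simp [mul_pow]
    ring
  have h₃ := integral_sub i₁ i₂
  have i₃ := i₁.sub i₂
  rw [h₂, sub_self] at h₃
  simp_rw [e] at h₃
  refine ⟨integrable_phaseMeasure_iff.1 (i₃.congr (Eventually.of_forall e)), ?_⟩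
  rw [phaseMeasure, integral_smul_measure, ENNReal.toReal_ofReal (by positivity)] at h₃
  exact (smul_eq_zero.1 h₃).resolve_left (inv_ne_zero Real.pi_ne_zero)

/-- Squares of test functions determine `‖ϖ‖ ^ 2 - 1`: if `f = 1` on the support of `g`, then `g = g
f` is a quarter of `(g + f)² - (g - f)²`. -/
theorem norm_weight_eq_one (hw : IsWeightIntegral ϖ M)
    (h : IsometricOn M integrableSquareIntegrable) : ∀ᵐ z, ‖ϖ z‖ = 1 := by
  have hloc : LocallyIntegrable fun z => ‖ϖ z‖ ^ 2 - 1 := by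
    intro x
    have f : ContDiffBump x := ⟨1, 2, one_pos, one_lt_two⟩
    refine ⟨Metric.closedBall x f.rIn, Metric.closedBall_mem_nhds x f.rIn_pos, ?_⟩
    refine (integral_sq_mul_weight hw h f.contDiff f.hasCompactSupport).1.integrableOn.congr_fun
      (fun z hz => ?_) Metric.isClosed_closedBall.measurableSet
    simp [f.one_of_mem_closedBall hz]
  have key := ae_eq_zero_of_integral_contDiff_smul_eq_zero hloc fun g hg hgc => by
    obtain ⟨R, hR⟩ := hgc.isBounded.subset_closedBall (0 : ℂ)
    -- `max R 1` keeps the inner radius positive whatever the sign of `R`.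
    let f : ContDiffBump (0 : ℂ) := ⟨max R 1, max R 1 + 1, by positivity, by linarith⟩
    have hfg : ∀ z, g z * f z = g z := fun z => by
      by_cases hz : z ∈ tsupport g
      · rw [f.one_of_mem_closedBall (Metric.closedBall_subset_closedBall (le_max_left _ _) (hR hz)),
          mul_one]
      · rw [image_eq_zero_of_notMem_tsupport hz, zero_mul]
    obtain ⟨i₁, e₁⟩ := integral_sq_mul_weight hw h (hg.add f.contDiff)
      (hgc.add f.hasCompactSupport)
    obtain ⟨i₂, e₂⟩ := integral_sq_mul_weight hw h (hg.sub f.contDiff)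
      (hgc.sub f.hasCompactSupport)
    have e : ∀ z, g z • (‖ϖ z‖ ^ 2 - 1) = (1 / 4 : ℝ) * ((g z + f z) ^ 2 * (‖ϖ z‖ ^ 2 - 1) -
        (g z - f z) ^ 2 * (‖ϖ z‖ ^ 2 - 1)) := fun z => by
      rw [smul_eq_mul]
      linear_combination -(‖ϖ z‖ ^ 2 - 1) * hfg z
    simp_rw [e]
    rw [integral_const_mul, integral_sub i₁ i₂, e₁, e₂, sub_self, mul_zero]
  filter_upwards [key] with z hz
  exact (pow_eq_one_iff_of_nonneg (norm_nonneg _) two_ne_zero).1 (sub_eq_zero.1 hz)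

/-- Since `D(z)† = D(-z)`, the substitution `z ↦ -z` turns the integral for `M†` into that of the
weight `conj (ϖ (-z))`, which is `ϖ z`. -/
theorem adjoint_eq_self_of_isRegularWeight (hw : IsWeightIntegral ϖ M) (hr : IsRegularWeight ϖ) :
    ContinuousLinearMap.adjoint M = M := by
  obtain ⟨V, hd, hV, hM⟩ := hw
  have hV' : ∀ φ ∈ V, ∀ ψ ∈ V, ⟪φ, ContinuousLinearMap.adjoint M ψ⟫_ℂ = ⟪φ, M ψ⟫_ℂ := by
    intro φ hφ ψ hψ
    rw [ContinuousLinearMap.adjoint_inner_right, ← inner_conj_symm, (hM ψ hψ φ hφ).2,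
      (hM φ hφ ψ hψ).2, ← integral_conj, integral_phaseMeasure, integral_phaseMeasure,
      ← integral_neg_eq_self]
    congr 1
    refine integral_congr_ae (Eventually.of_forall fun z => ?_)
    simp only [map_mul]
    rw [hr.2, hr.1, inner_conj_symm, ← adjoint_D, ContinuousLinearMap.adjoint_inner_left]
  refine ContinuousLinearMap.ext fun ψ => ?_
  refine congrFun (Continuous.ext_on hd (by fun_prop) (by fun_prop) fun ψ hψ => ?_) ψ
  exact hd.eq_of_inner_right ℂ fun φ hφ => hV' φ hφ ψ hψ

end

end WeylHeisenberg

end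

open WeylHeisenberg
theorem mainTheorem8 (ϖ : ℂ → ℂ) (hϖ0 : ϖ 0 = 1)
    (M : WeylHeisenberg.H →L[ℂ] WeylHeisenberg.H) (hM : IsWeightIntegral ϖ M) :
    (IsometricOn M squareIntegrable ↔ ∀ᵐ z ∂(MeasureTheory.volume : MeasureTheory.Measure ℂ), ‖ϖ z‖ = 1) ∧
    (IsometricOn M integrableSquareIntegrable ↔
      ∀ᵐ z ∂(MeasureTheory.volume : MeasureTheory.Measure ℂ), ‖ϖ z‖ = 1) ∧
    (Continuous ϖ → (IsometricOn M squareIntegrable ↔ ∀ z, ‖ϖ z‖ = 1)) ∧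
    ((∀ᵐ z ∂(MeasureTheory.volume : MeasureTheory.Measure ℂ), ‖ϖ z‖ = 1) →
      IsInvertible M ∧
      InverseIsTrace M (ContinuousLinearMap.adjoint M) ∧
      (IsRegularWeight ϖ → ContinuousLinearMap.adjoint M = M ∧ InverseIsTrace M M)) := by
  have hmono : IsometricOn M squareIntegrable → IsometricOn M integrableSquareIntegrable :=
    fun h f hf => h f hf.2
  have h₁ : IsometricOn M squareIntegrable ↔ ∀ᵐ z, ‖ϖ z‖ = 1 :=
    ⟨fun h => norm_weight_eq_one hM (hmono h), fun h => (isMoyalFrame_displaced hM h).isometricOn⟩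
  refine ⟨h₁, ⟨norm_weight_eq_one hM, fun h => hmono (h₁.2 h)⟩, fun hc => h₁.trans ?_, fun h => ?_⟩
  · exact ⟨fun h z => congrFun ((Continuous.ae_eq_iff_eq volume hc.norm continuous_const).1 h) z,
      fun h => Eventually.of_forall h⟩
  · have hF := isMoyalFrame_displaced hM h
    refine ⟨hF.isInvertible, hF.inverseIsTrace, fun hr => ?_⟩
    have hs := adjoint_eq_self_of_isRegularWeight hM hr
    refine ⟨hs, ?_⟩
    have ht := hF.inverseIsTrace
    rwa [hs] at ht
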